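/- **Setting.** Let $\Sigma^*=(\sigma^*_{ij})$ be a positive definite $p\times p$ matrix with $\sigma^*_{jj}=1$ for all $j$, and let $\Theta^*=(\theta^*_{ij})=(\Sigma^*)^{-1}$. A random vector $X=(X_1,\dots,X_p)$ is *nonparanormal* with parameter $\Sigma^*$ if there are univariate increasing transformations $f_1,\dots,f_p$ with $(f_1(X_1),\dots,f_p(X_p))\sim N_p(0,\Sigma^*)$. Let $x_1,\dots,x_n$, $n\ge 2$, be i.i.d. observations of such an $X$. Let $\hat r_{ij}$ be Spearman's rank correlation of the $i$th and $j$th variables (Pearson's correlation of their ranks), $\hat r^s_{ij}=2\sin(\frac{\pi}{6}\hat r_{ij})$ and $\hat R^s=(\hat r^s_{ij})$. For $\lambda>0$ the rank-based graphical lasso estimator is the (unique) minimizer $$\hat\Theta=\hat\Theta^s_g=\arg\min_{\Theta\succ0}\ -\log\det\Theta+\mathrm{tr}(\hat R^s\Theta)+\lambda\sum_{i\ne j}|\theta_{ij}| .$$ **Notation.** $\|A\|_{\ell_\infty}=\max_i\sum_j|a_{ij}|$, $\|A\|_{\max}=\max_{i,j}|a_{ij}|$. Let $\mathcal A=\{(i,j):\theta^*_{ij}\ne0\}$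 (the off-diagonal support of $\Theta^*$ together with the diagonal pairs $(i,i)$) and let $\mathcal A^c$ be its complement among all index pairs. Let $d=\max_j\#\{i\neq j:\theta^*_{ij}\ne0\}$, $\psi_{\min}=\min_{i\ne j,\ \theta^*_{ij}\neq0}|\theta^*_{ij}|$ ($=\infty$ if $d=0$), $H^*=\Sigma^*\otimes\Sigma^*$ (indexed by pairs), $K_{\Sigma^*}=\|\Sigma^*\|_{\ell_\infty}$, $K_{H^*}=\|(H^*_{\mathcal A\mathcal A})^{-1}\|_{\ell_\infty}$. **Theorem.** There is an absolute constant $c_0>0$ such that the following holds for all such $n,p,\Sigma^*$ and all such nonparanormal distributions. Let $\kappa\in(0,1)$ and assume $\|H^*_{\mathcal A^c\mathcal A}(H^*_{\mathcal A\mathcal A})^{-1}\|_{\ell_\infty}<1-\kappa$. (a) If $$0<\lambda<\frac{1}{6(1+\kappa/4)K_{\Sigma^*}K_{H^*}\max\{1,(1+4/\kappa)K_{\Sigma^*}^2K_{H^*}\}}\cdot\frac1d$$ (no upper bound on $\lambda$ if $d=0$), then with probability at least $1-p^2\exp(-\frac{\kappa^2}{16}c_0n\lambda^2)$ the estimator $\hat\Theta$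 exists and is unique, $\hat\theta_{ij}=0$ for all $(i,j)\in\mathcal A^c$, and $\|\hat\Theta-\Theta^*\|_{\max}\le 2K_{H^*}(1+\frac{\kappa}{4})\lambda$. (b) If in addition $\lambda<\dfrac{\psi_{\min}}{2(1+\kappa/4)K_{H^*}}$, then with probability at least $1-p^2\exp(-\frac{\kappa^2}{16}c_0n\lambda^2)$ the estimator exists, is unique and is sign consistent: $\mathrm{sign}(\hat\theta_{ij})=\mathrm{sign}(\theta^*_{ij})$ for all $(i,j)\in\mathcal A$, and $\hat\theta_{ij}=0$ for all $(i,j)\in\mathcal A^c$. -/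

import Mathlib

open MeasureTheory ProbabilityTheory
open scoped Kronecker

noncomputable section

namespace RankGlasso

/-- The matrix `ℓ∞` norm: the maximal absolute row sum (`0` if there are no rows). -/
def linfNorm {m n : Type*} [Fintype n] (A : Matrix m n ℝ) : ℝ :=
  ⨆ i, ∑ j, |A i j|

/-- The entrywise maximum norm (`0` for an empty matrix). -/
def maxNorm {m n : Type*} (A : Matrix m n ℝ) : ℝ :=
  ⨆ e : m × n, |A e.1 e.2|

/-- Distribution `P` of a random vector `X` is nonparanormal with parameter `S`: there are
univariate increasing transformations `f j` with `(f 1 (X 1), …, f p (X p)) ∼ N(0, S)`.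
Each `f j` is only required to be defined (and increasing) on a set `D j` that carries the `j`-th
coordinate, because for instance `Φ⁻¹ ∘ F j` is finite only inside the range of `X j`. -/
def IsNonparanormal {p : ℕ} (P : Measure (Fin p → ℝ)) (S : Matrix (Fin p) (Fin p) ℝ) : Prop :=
  ∃ (f : Fin p → ℝ → ℝ) (D : Fin p → Set ℝ),
    (∀ j, MonotoneOn (f j) (D j)) ∧
    (∀ᵐ x ∂P, ∀ j, x j ∈ D j) ∧
    HasLaw (fun x : Fin p → ℝ => WithLp.toLp 2 (fun j => f j (x j)))
      (multivariateGaussian 0 S) P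

/-- The rank of the `k`-th observation among `v 0, …, v (n-1)` (midranks in case of ties):
without ties this is `#{l | v l ≤ v k}`. -/
def rank {n : ℕ} (v : Fin n → ℝ) (k : Fin n) : ℝ :=
  (((Finset.univ.filter fun l => v l < v k).card : ℝ)
    + ((Finset.univ.filter fun l => v l ≤ v k).card : ℝ) + 1) / 2

/-- The sample mean. -/
def mean {n : ℕ} (a : Fin n → ℝ) : ℝ := (∑ k, a k) / n

/-- Pearson's sample correlation. -/
def pearson {n : ℕ} (a b : Fin n → ℝ) : ℝ :=
  (∑ k, (a k - mean a) * (b k - mean b)) /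
    (Real.sqrt (∑ k, (a k - mean a) ^ 2) * Real.sqrt (∑ k, (b k - mean b) ^ 2))

/-- Spearman's rank correlation of variables `i` and `j`; `x k i` is the `k`-th observation of
the `i`-th variable. -/
def spearman {n p : ℕ} (x : Fin n → Fin p → ℝ) (i j : Fin p) : ℝ :=
  pearson (rank fun k => x k i) (rank fun k => x k j)

/-- The rank-based sample correlation matrix: adjusted Spearman correlations. -/
def rankCorr {n p : ℕ} (x : Fin n → Fin p → ℝ) : Matrix (Fin p) (Fin p) ℝ :=
  Matrix.of fun i j => 2 * Real.sin (Real.pi / 6 * spearman x i j)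

/-- The graphical lasso objective `-log det Θ + tr(R Θ) + lam ∑_{i ≠ j} |θ_{ij}|`. -/
def glassoObj {p : ℕ} (R : Matrix (Fin p) (Fin p) ℝ) (lam : ℝ)
    (Θ : Matrix (Fin p) (Fin p) ℝ) : ℝ :=
  -Real.log Θ.det + (R * Θ).trace + lam * ∑ i, ∑ j, if i ≠ j then |Θ i j| else 0

/-- `Θ` is a minimizer of the graphical lasso objective over positive definite matrices. -/
def IsGlassoMin {p : ℕ} (R : Matrix (Fin p) (Fin p) ℝ) (lam : ℝ)
    (Θ : Matrix (Fin p) (Fin p) ℝ) : Prop :=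
  Θ.PosDef ∧ ∀ Θ' : Matrix (Fin p) (Fin p) ℝ, Θ'.PosDef → glassoObj R lam Θ ≤ glassoObj R lam Θ'

/-- `Θ` is the rank-based graphical lasso estimator for the data `x`: the unique minimizer of
the graphical lasso objective fed with the rank-based correlation matrix. -/
def IsRankGlasso {n p : ℕ} (x : Fin n → Fin p → ℝ) (lam : ℝ)
    (Θ : Matrix (Fin p) (Fin p) ℝ) : Prop :=
  IsGlassoMin (rankCorr x) lam Θ ∧ ∀ Θ', IsGlassoMin (rankCorr x) lam Θ' → Θ' = Θ

/-- The support of `Θ`, as a set of index pairs. For a positive definite `Θ` it consists of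
the off-diagonal support together with the whole diagonal. -/
def supp {p : ℕ} (Θ : Matrix (Fin p) (Fin p) ℝ) (e : Fin p × Fin p) : Prop := Θ e.1 e.2 ≠ 0

/-- The maximal degree of the graph of `Θ` (the diagonal is not counted). -/
def maxDegree {p : ℕ} (Θ : Matrix (Fin p) (Fin p) ℝ) : ℕ :=
  Finset.univ.sup fun j => (Finset.univ.filter fun i => i ≠ j ∧ Θ i j ≠ 0).card

/-- The smallest absolute value of a nonzero off-diagonal entry (`⊤` if there is none). -/
def psiMin {p : ℕ} (Θ : Matrix (Fin p) (Fin p) ℝ) : EReal :=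
  ⨅ (i : Fin p) (j : Fin p) (_ : i ≠ j ∧ Θ i j ≠ 0), ((|Θ i j| : ℝ) : EReal)

/-- `H = S ⊗ S`. -/
def hess {p : ℕ} (S : Matrix (Fin p) (Fin p) ℝ) : Matrix (Fin p × Fin p) (Fin p × Fin p) ℝ :=
  S ⊗ₖ S

open Classical in
/-- `(H_{AA})⁻¹`, where `A` is the support of `S⁻¹`. -/
def hessSSInv {p : ℕ} (S : Matrix (Fin p) (Fin p) ℝ) :
    Matrix {e // supp S⁻¹ e} {e // supp S⁻¹ e} ℝ :=
  ((hess S).toBlock (supp S⁻¹) (supp S⁻¹))⁻¹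

open Classical in
/-- `K_H = ‖(H_{AA})⁻¹‖_{ℓ∞}`. -/
def KH {p : ℕ} (S : Matrix (Fin p) (Fin p) ℝ) : ℝ := linfNorm (hessSSInv S)

open Classical in
/-- `‖H_{AᶜA} (H_{AA})⁻¹‖_{ℓ∞}`, the quantity in the irrepresentable condition. -/
def irrep {p : ℕ} (S : Matrix (Fin p) (Fin p) ℝ) : ℝ :=
  linfNorm ((hess S).toBlock (fun e => ¬ supp S⁻¹ e) (supp S⁻¹) * hessSSInv S)

end RankGlasso

end

/-!
The proof has a deterministic and a probabilistic half, which meet in the event that the rank-based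
correlation matrix `R` satisfies `|R i j - S i j| ≤ κ / 4 * lam` for all `i`, `j`.

**Deterministic half** (`glasso_of_close`): the primal-dual witness argument. Minimize the objective
over the positive definite matrices supported on the graph of `S⁻¹`; a minimizer `Θ` exists by
compactness (`exists_min_on_closed`) and is stationary on the support (`kkt_of_restricted_min`).
There `Θ⁻¹` differs from `S` by at most `(1 + κ / 4) * lam`. A Newton iteration frozen at `S⁻¹` is a
contraction of the ball of radius `(3 / 2) * K_H * lam` in the maximum norm and yields a matrix
`S⁻¹ + Δ`, with `Δ` in this ball and on that support, whose inverse agrees with `Θ⁻¹` on the support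
(`exists_inv_eq_on_support`). By strict convexity of `-log det` such a matrix is unique
(`eq_of_inv_eq_on`), so `Θ = S⁻¹ + Δ` is close to `S⁻¹`. Expanding the inverse,
`R - Θ⁻¹` equals `S Δ S` up to `R - S` and a quadratic remainder, and the irrepresentable condition
transfers the bound on `S Δ S` from the support to its complement
(`abs_mul_mul_le_irrep`): the dual feasibility condition holds everywhere, which makes `Θ` the
unique minimizer over all positive definite matrices (`isGlassoMin_of_kkt`).

**Probabilistic half** (`exists_event_rankCorr_close`). Ranks do not change under increasing
transformations, so the data may be taken Gaussian. Without ties Spearman's correlation is, up to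
`O(1 / n)`, three times the average of `sign (x_k - x_l) * sign (y_k - y_m)` over triples of
distinct indices (`abs_spearman_sub_le`). The mean of a summand is `(2 / π) * arcsin (S i j / 2)` by
Sheppard's formula (`integral_sign_diff`), so that the correction `2 * sin (π / 6 * r)` recovers
`S i j`. The average over triples is a `U`-statistic, hence an average over permutations of averages
over disjoint blocks, and therefore sub-Gaussian (`exists_ustatistic`). A union bound over the pairs
`i < j` concludes.
-/

namespace RankGlasso

open Matrix

/-! ### Convexity of `-log det` -/

lemma isClosed_posSemidef {ι : Type*} [Fintype ι] : IsClosed {M : Matrix ι ι ℝ | M.PosSemidef} := by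
  have : {M : Matrix ι ι ℝ | M.PosSemidef} =
      {M : Matrix ι ι ℝ | Mᵀ = M} ∩ ⋂ x : ι → ℝ, {M | 0 ≤ x ⬝ᵥ (M *ᵥ x)} := by
    ext M
    simp [posSemidef_iff_dotProduct_mulVec, IsHermitian, conjTranspose_eq_transpose_of_trivial]
  rw [this]
  refine (isClosed_eq (by fun_prop) continuous_id).inter (isClosed_iInter fun x => ?_)
  exact isClosed_le continuous_const (by fun_prop)

section LogDet

variable {ι : Type*} [Fintype ι] [DecidableEq ι]

lemma log_det_le_trace_sub_card {M : Matrix ι ι ℝ} (hM : M.PosDef) :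
    Real.log M.det ≤ M.trace - Fintype.card ι := by
  have h1 : M.det = ∏ i, hM.1.eigenvalues i := by simpa using hM.1.det_eq_prod_eigenvalues
  have h2 : M.trace = ∑ i, hM.1.eigenvalues i := by simpa using hM.1.trace_eq_sum_eigenvalues
  rw [h1, h2, Real.log_prod (fun i _ => (hM.eigenvalues_pos i).ne')]
  have : (Fintype.card ι : ℝ) = ∑ _i : ι, (1 : ℝ) := by simp
  rw [this, ← Finset.sum_sub_distrib]
  exact Finset.sum_le_sum fun i _ => Real.log_le_sub_one_of_pos (hM.eigenvalues_pos i)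

lemma eq_one_of_log_det_eq {M : Matrix ι ι ℝ} (hM : M.PosDef)
    (h : Real.log M.det = M.trace - Fintype.card ι) : M = 1 := by
  have h1 : M.det = ∏ i, hM.1.eigenvalues i := by simpa using hM.1.det_eq_prod_eigenvalues
  have h2 : M.trace = ∑ i, hM.1.eigenvalues i := by simpa using hM.1.trace_eq_sum_eigenvalues
  rw [h1, h2, Real.log_prod (fun i _ => (hM.eigenvalues_pos i).ne')] at h
  have : (Fintype.card ι : ℝ) = ∑ _i : ι, (1 : ℝ) := by simp
  rw [this, ← Finset.sum_sub_distrib] at h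
  have h3 := (Finset.sum_eq_sum_iff_of_le
    fun i _ => Real.log_le_sub_one_of_pos (hM.eigenvalues_pos i)).1 h
  have h4 : ∀ i, hM.1.eigenvalues i = 1 := by
    intro i
    by_contra hne
    exact (Real.log_lt_sub_one_of_pos (hM.eigenvalues_pos i) hne).ne (h3 i (Finset.mem_univ i))
  have h5 : hM.1.eigenvalues = 1 := funext h4
  rw [hM.1.spectral_theorem, h5]
  have : diagonal (RCLike.ofReal ∘ (1 : ι → ℝ) : ι → ℝ) = 1 := by
    ext i j; simp [diagonal, one_apply]
  rw [this, map_one]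

open scoped MatrixOrder in
lemma exists_factor {A : Matrix ι ι ℝ} (hA : A.PosDef) :
    ∃ B : Matrix ι ι ℝ, IsUnit B ∧ A = Bᵀ * B := by
  obtain ⟨B, hB, h⟩ := CStarAlgebra.isStrictlyPositive_iff_eq_star_mul_self.1 hA.isStrictlyPositive
  exact ⟨B, hB, by simpa [star_eq_conjTranspose, conjTranspose_eq_transpose_of_trivial] using h⟩

lemma posDef_congr {A B : Matrix ι ι ℝ} (hA : A.PosDef) (hB : IsUnit B) :
    (B * A * Bᵀ).PosDef := by
  have := (Matrix.IsUnit.posDef_star_right_conjugate_iff (x := A) hB).2 hA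
  simpa [star_eq_conjTranspose, conjTranspose_eq_transpose_of_trivial] using this

/-- Concavity of `log det`, in the form of its tangent inequality at `A`. -/
lemma log_det_sub_le {A B : Matrix ι ι ℝ} (hA : A.PosDef) (hB : B.PosDef) :
    Real.log B.det - Real.log A.det ≤ (A⁻¹ * B).trace - Fintype.card ι := by
  obtain ⟨C, hC, h⟩ := exists_factor hA.inv
  have hM := posDef_congr hB hC
  have h1 := log_det_le_trace_sub_card hM
  have hd : (C * B * Cᵀ).det = A.det⁻¹ * B.det := by
    have : A⁻¹.det = Cᵀ.det * C.det := by rw [h, det_mul]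
    rw [det_nonsing_inv, Ring.inverse_eq_inv'] at this
    rw [this, det_mul, det_mul]; ring
  have ht : (C * B * Cᵀ).trace = (A⁻¹ * B).trace := by
    rw [h, trace_mul_comm, ← Matrix.mul_assoc]
  rw [hd, Real.log_mul (inv_ne_zero hA.det_pos.ne') hB.det_pos.ne', Real.log_inv, ht] at h1
  linarith

/-- Strict concavity of `log det`: the tangent inequality is an equality only at the point of
tangency. -/
lemma eq_of_log_det_sub_eq {A B : Matrix ι ι ℝ} (hA : A.PosDef) (hB : B.PosDef)
    (he : Real.log B.det - Real.log A.det = (A⁻¹ * B).trace - Fintype.card ι) : B = A := by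
  obtain ⟨C, hC, h⟩ := exists_factor hA.inv
  have hM := posDef_congr hB hC
  have hd : (C * B * Cᵀ).det = A.det⁻¹ * B.det := by
    have : A⁻¹.det = Cᵀ.det * C.det := by rw [h, det_mul]
    rw [det_nonsing_inv, Ring.inverse_eq_inv'] at this
    rw [this, det_mul, det_mul]; ring
  have ht : (C * B * Cᵀ).trace = (A⁻¹ * B).trace := by
    rw [h, trace_mul_comm, ← Matrix.mul_assoc]
  have h1 : C * B * Cᵀ = 1 := by
    apply eq_one_of_log_det_eq hM
    rw [hd, Real.log_mul (inv_ne_zero hA.det_pos.ne') hB.det_pos.ne', Real.log_inv, ht]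
    linarith
  have hCd : IsUnit C.det := (isUnit_iff_isUnit_det C).1 hC
  have h2 : B * Cᵀ * C = 1 := by
    have : C * (B * Cᵀ) = 1 := by rw [← Matrix.mul_assoc, h1]
    exact mul_eq_one_comm.1 this
  rw [Matrix.mul_assoc, ← h] at h2
  have hAd : IsUnit A.det := hA.det_pos.ne'.isUnit
  calc B = B * A⁻¹ * A := by rw [Matrix.mul_assoc, nonsing_inv_mul A hAd, Matrix.mul_one]
    _ = A := by rw [h2, Matrix.one_mul]

/-- A positive definite matrix supported on `U` is determined by the entries of its inverse
on `U`: the problem `min -log det Θ + tr (b Θ)` over such matrices is strictly convex. -/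
lemma eq_of_inv_eq_on {A B : Matrix ι ι ℝ} (hA : A.PosDef) (hB : B.PosDef)
    (h : ∀ i j, A⁻¹ i j = B⁻¹ i j ∨ (A j i = 0 ∧ B j i = 0)) : A = B := by
  have h1 := log_det_sub_le hA hB
  have h2 := log_det_sub_le hB hA
  have e1 : (A⁻¹ * A).trace = Fintype.card ι := by
    rw [nonsing_inv_mul _ hA.det_pos.ne'.isUnit, trace_one]
  have e2 : (B⁻¹ * B).trace = Fintype.card ι := by
    rw [nonsing_inv_mul _ hB.det_pos.ne'.isUnit, trace_one]
  have e3 : (A⁻¹ * B).trace - (B⁻¹ * B).trace = (A⁻¹ * A).trace - (B⁻¹ * A).trace := by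
    simp only [trace, diag_apply, mul_apply, ← Finset.sum_sub_distrib]
    refine Finset.sum_congr rfl fun i _ => Finset.sum_congr rfl fun j _ => ?_
    rcases h i j with h | ⟨h, h'⟩
    · rw [h]; ring
    · rw [h, h']
  symm
  apply eq_of_log_det_sub_eq hA hB
  linarith

lemma abs_apply_le_half_add {N : Matrix ι ι ℝ} (hN : N.PosSemidef) (i j : ι) :
    |N i j| ≤ (N i i + N j j) / 2 := by
  have hs : N j i = N i j := by simpa using hN.1.apply i j
  by_cases hij : i = j
  · subst hij
    rw [abs_of_nonneg hN.diag_nonneg, add_self_div_two]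
  have key : ∀ s : ℝ, s ^ 2 = 1 → 0 ≤ N i i + N j j + 2 * s * N i j := by
    intro s hs2
    have := hN.dotProduct_mulVec_nonneg (Pi.single i 1 + s • Pi.single j 1)
    simp [mulVec_add, add_dotProduct, dotProduct_add, mulVec_smul, hs] at this
    linear_combination this + N j j * hs2
  have h1 := key 1 (by norm_num)
  have h2 := key (-1) (by norm_num)
  rw [abs_le]; constructor <;> linarith

lemma abs_apply_le_trace {N : Matrix ι ι ℝ} (hN : N.PosSemidef) (i j : ι) :
    |N i j| ≤ N.trace := by
  have hle : ∀ k, N k k ≤ N.trace := fun k =>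
    Finset.single_le_sum (f := fun k => N k k) (fun k _ => hN.diag_nonneg) (Finset.mem_univ k)
  have := abs_apply_le_half_add hN i j
  linarith [hle i, hle j]

end LogDet

/-! ### The `ℓ∞` matrix norm and perturbation of the inverse -/

section LinfNorm

variable {m n k : Type*} [Fintype m] [Fintype n] [Fintype k]

lemma sum_abs_le_linfNorm (A : Matrix m n ℝ) (i : m) : ∑ j, |A i j| ≤ linfNorm A :=
  le_ciSup (f := fun i => ∑ j, |A i j|) (Set.finite_range _).bddAbove i

lemma linfNorm_nonneg {m n : Type*} [Fintype n] (A : Matrix m n ℝ) : 0 ≤ linfNorm A :=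
  Real.iSup_nonneg fun _ => Finset.sum_nonneg fun _ _ => abs_nonneg _

lemma linfNorm_le {m n : Type*} [Fintype n] {A : Matrix m n ℝ} {c : ℝ} (hc : 0 ≤ c)
    (h : ∀ i, ∑ j, |A i j| ≤ c) : linfNorm A ≤ c :=
  Real.iSup_le h hc

lemma abs_sum_mul_le (A : Matrix m n ℝ) (v : n → ℝ) {c : ℝ} (hc : ∀ j, |v j| ≤ c) (hc0 : 0 ≤ c)
    (i : m) : |∑ j, A i j * v j| ≤ linfNorm A * c := by
  calc |∑ j, A i j * v j| ≤ ∑ j, |A i j| * c := by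
        refine (Finset.abs_sum_le_sum_abs _ _).trans (Finset.sum_le_sum fun j _ => ?_)
        rw [abs_mul]
        exact mul_le_mul_of_nonneg_left (hc j) (abs_nonneg _)
    _ = (∑ j, |A i j|) * c := by rw [Finset.sum_mul]
    _ ≤ _ := mul_le_mul_of_nonneg_right (sum_abs_le_linfNorm A i) hc0

lemma abs_mul_apply_le {m n k : Type*} [Fintype m] [Fintype n] (A : Matrix m n ℝ)
    (B : Matrix n k ℝ) {c : ℝ} (hc : ∀ i j, |B i j| ≤ c) (hc0 : 0 ≤ c) (i : m)
    (j : k) : |(A * B) i j| ≤ linfNorm A * c := by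
  rw [mul_apply]
  exact abs_sum_mul_le A (fun l => B l j) (fun l => hc l j) hc0 i

lemma abs_mul_apply_le' {m n k : Type*} [Fintype n] [Fintype k] (A : Matrix m n ℝ)
    (B : Matrix n k ℝ) {c : ℝ} (hc : ∀ i j, |A i j| ≤ c) (hc0 : 0 ≤ c) (i : m)
    (j : k) : |(A * B) i j| ≤ c * linfNorm Bᵀ := by
  rw [← transpose_apply (A * B), transpose_mul, mul_comm]
  exact abs_mul_apply_le Bᵀ Aᵀ (fun i j => hc j i) hc0 j i

lemma linfNorm_mul_le (A : Matrix m n ℝ) (B : Matrix n k ℝ) :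
    linfNorm (A * B) ≤ linfNorm A * linfNorm B := by
  refine linfNorm_le (mul_nonneg (linfNorm_nonneg _) (linfNorm_nonneg _)) fun i => ?_
  calc ∑ j, |(A * B) i j| ≤ ∑ j, ∑ l, |A i l| * |B l j| := by
        refine Finset.sum_le_sum fun j _ => ?_
        rw [mul_apply]
        refine (Finset.abs_sum_le_sum_abs _ _).trans (Finset.sum_le_sum fun l _ => ?_)
        rw [abs_mul]
    _ = ∑ l, |A i l| * ∑ j, |B l j| := by
        rw [Finset.sum_comm]; simp_rw [Finset.mul_sum]
    _ ≤ ∑ l, |A i l| * linfNorm B := Finset.sum_le_sum fun l _ =>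
        mul_le_mul_of_nonneg_left (sum_abs_le_linfNorm B l) (abs_nonneg _)
    _ = (∑ l, |A i l|) * linfNorm B := by rw [Finset.sum_mul]
    _ ≤ _ := mul_le_mul_of_nonneg_right (sum_abs_le_linfNorm A i) (linfNorm_nonneg _)

lemma linfNorm_add_le (A B : Matrix m n ℝ) : linfNorm (A + B) ≤ linfNorm A + linfNorm B := by
  refine linfNorm_le (add_nonneg (linfNorm_nonneg _) (linfNorm_nonneg _)) fun i => ?_
  calc ∑ j, |(A + B) i j| ≤ ∑ j, (|A i j| + |B i j|) :=
        Finset.sum_le_sum fun j _ => abs_add_le _ _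
    _ ≤ _ := by
        rw [Finset.sum_add_distrib]
        exact add_le_add (sum_abs_le_linfNorm A i) (sum_abs_le_linfNorm B i)

lemma linfNorm_neg {m n : Type*} [Fintype n] (A : Matrix m n ℝ) : linfNorm (-A) = linfNorm A := by
  simp [linfNorm]

lemma linfNorm_smul {m n : Type*} [Fintype n] (t : ℝ) (A : Matrix m n ℝ) :
    linfNorm (t • A) = |t| * linfNorm A := by
  simp [linfNorm, abs_mul, ← Finset.mul_sum, Real.mul_iSup_of_nonneg]

/-- In the sup norm of vectors, `A` is bounded by its `ℓ∞` norm; hence so are its eigenvalues. -/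
lemma abs_eigenvalue_le [DecidableEq n] {A : Matrix n n ℝ} {u : n → ℝ} {μ : ℝ} (hu : u ≠ 0)
    (h : A *ᵥ u = μ • u) : |μ| ≤ linfNorm A := by
  have hn : 0 < ‖u‖ := norm_pos_iff.2 hu
  refine le_of_mul_le_mul_right ?_ hn
  have : ‖μ • u‖ ≤ linfNorm A * ‖u‖ := by
    rw [pi_norm_le_iff_of_nonneg (mul_nonneg (linfNorm_nonneg _) hn.le)]
    intro i
    rw [← h, Real.norm_eq_abs]
    exact abs_sum_mul_le A u (fun j => norm_le_pi_norm u j) hn.le i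
  rwa [norm_smul] at this

variable [DecidableEq n]

lemma isUnit_det_one_add {A : Matrix n n ℝ} (h : linfNorm A < 1) : IsUnit (1 + A).det := by
  rw [isUnit_iff_ne_zero]
  intro h0
  obtain ⟨v, hv, hv0⟩ := exists_mulVec_eq_zero_iff.2 h0
  have : A *ᵥ v = (-1 : ℝ) • v := by
    rw [add_mulVec, one_mulVec] at hv0
    rw [neg_one_smul]; exact eq_neg_of_add_eq_zero_right hv0
  have := abs_eigenvalue_le hv this
  simp at this
  linarith

/-- A symmetric perturbation `E` of `S⁻¹` keeps it positive definite if `S * E` is small in the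
`ℓ∞` norm, since this norm bounds the spectral radius of `S * E`, which is similar to a
symmetric matrix. -/
lemma posDef_inv_add {S E : Matrix n n ℝ} (hS : S.PosDef) (hE : Eᵀ = E)
    (h : linfNorm (S * E) < 1) : (S⁻¹ + E).PosDef := by
  obtain ⟨B, hB, rfl⟩ := exists_factor hS
  have hBd : IsUnit B.det := (isUnit_iff_isUnit_det B).1 hB
  have hBt : IsUnit Bᵀ.det := by rwa [det_transpose]
  have hN : (1 + B * E * Bᵀ).IsHermitian := by
    rw [IsHermitian, conjTranspose_eq_transpose_of_trivial]
    simp [transpose_mul, hE, Matrix.mul_assoc]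
  have hpos : (1 + B * E * Bᵀ).PosDef := by
    rw [hN.posDef_iff_eigenvalues_pos]
    intro i
    set v : n → ℝ := (hN.eigenvectorBasis i).ofLp with hv
    have hv0 : v ≠ 0 := by
      intro h0
      have : hN.eigenvectorBasis i = 0 := by ext j; exact congrFun h0 j
      exact hN.eigenvectorBasis.orthonormal.ne_zero i this
    have hev : (1 + B * E * Bᵀ) *ᵥ v = hN.eigenvalues i • v := hN.mulVec_eigenvectorBasis i
    have hu0 : Bᵀ *ᵥ v ≠ 0 := by
      intro h0
      apply hv0
      have : Bᵀ⁻¹ *ᵥ (Bᵀ *ᵥ v) = v := by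
        rw [mulVec_mulVec, nonsing_inv_mul _ hBt, one_mulVec]
      rw [← this, h0, mulVec_zero]
    have heq : (Bᵀ * B * E) *ᵥ (Bᵀ *ᵥ v) = (hN.eigenvalues i - 1) • (Bᵀ *ᵥ v) := by
      rw [add_mulVec, one_mulVec] at hev
      have h1 : (B * E * Bᵀ) *ᵥ v = (hN.eigenvalues i - 1) • v := by
        rw [sub_smul, one_smul, ← hev]; abel
      rw [mulVec_mulVec, ← mulVec_smul, ← h1, mulVec_mulVec]
      simp only [Matrix.mul_assoc]
    have := (abs_lt.1 ((abs_eigenvalue_le hu0 heq).trans_lt h)).1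
    linarith
  have hBi : IsUnit B⁻¹ := (isUnit_iff_isUnit_det _).2 (isUnit_nonsing_inv_det B hBd)
  have h2 := posDef_congr hpos hBi
  have : B⁻¹ * (1 + B * E * Bᵀ) * B⁻¹ᵀ = (Bᵀ * B)⁻¹ + E := by
    rw [Matrix.mul_add, Matrix.add_mul, Matrix.mul_inv_rev, Matrix.mul_one, transpose_nonsing_inv]
    congr 1
    rw [← Matrix.mul_assoc, ← Matrix.mul_assoc, nonsing_inv_mul _ hBd, Matrix.one_mul,
      Matrix.mul_assoc, mul_nonsing_inv _ hBt, Matrix.mul_one]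
  rwa [this] at h2

lemma isUnit_det_inv_add {S E : Matrix n n ℝ} (hS : IsUnit S.det) (h : linfNorm (S * E) < 1) :
    IsUnit (S⁻¹ + E).det := by
  have : S⁻¹ + E = S⁻¹ * (1 + S * E) := by
    rw [Matrix.mul_add, Matrix.mul_one, ← Matrix.mul_assoc, nonsing_inv_mul _ hS, Matrix.one_mul]
  rw [this, det_mul]
  exact (isUnit_nonsing_inv_det S hS).mul (isUnit_det_one_add h)

lemma sub_inv_add_inv {S E : Matrix n n ℝ} (hS : IsUnit S.det) (h : IsUnit (S⁻¹ + E).det) :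
    S - (S⁻¹ + E)⁻¹ = S * E * (S⁻¹ + E)⁻¹ := by
  have h1 : S * (S⁻¹ + E) * (S⁻¹ + E)⁻¹ = S := by
    rw [Matrix.mul_assoc, mul_nonsing_inv _ h, Matrix.mul_one]
  rw [Matrix.mul_add, mul_nonsing_inv _ hS, Matrix.add_mul, Matrix.one_mul] at h1
  rw [sub_eq_iff_eq_add']; exact h1.symm

lemma linfNorm_inv_add_inv_le {S E : Matrix n n ℝ} (hS : IsUnit S.det) {q : ℝ}
    (h : linfNorm (S * E) ≤ q) (hq : q < 1) :
    linfNorm (S⁻¹ + E)⁻¹ ≤ linfNorm S / (1 - q) := by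
  have hu := isUnit_det_inv_add hS (h.trans_lt hq)
  have h1 := sub_inv_add_inv hS hu
  set P := (S⁻¹ + E)⁻¹
  have h2 : P = S + -(S * E * P) := by rw [← h1]; abel
  have h3 : linfNorm P ≤ linfNorm S + q * linfNorm P := by
    calc linfNorm P = linfNorm (S + -(S * E * P)) := by rw [← h2]
      _ ≤ linfNorm S + linfNorm (S * E * P) := by
          refine (linfNorm_add_le _ _).trans ?_
          rw [linfNorm_neg]
      _ ≤ _ := by
          gcongr
          exact (linfNorm_mul_le _ _).trans (mul_le_mul_of_nonneg_right h (linfNorm_nonneg _))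
  rw [le_div_iff₀ (by linarith)]
  linarith

end LinfNorm

/-! ### Optimality conditions and existence for the graphical lasso -/

section Optimality

variable {p : ℕ}

/-- The penalty `∑_{i ≠ j} |θ_{ij}|`. -/
noncomputable def offDiagNorm (Θ : Matrix (Fin p) (Fin p) ℝ) : ℝ :=
  ∑ i, ∑ j, if i ≠ j then |Θ i j| else 0

lemma glassoObj_eq (R : Matrix (Fin p) (Fin p) ℝ) (lam : ℝ) (Θ : Matrix (Fin p) (Fin p) ℝ) :
    glassoObj R lam Θ = -Real.log Θ.det + (R * Θ).trace + lam * offDiagNorm Θ := rfl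

lemma trace_mul_add_nonneg {G Θ : Matrix (Fin p) (Fin p) ℝ} {lam : ℝ} (hΘ : Θᵀ = Θ)
    (h0 : ∀ i, G i i = 0) (h : ∀ i j, |G i j| ≤ lam) :
    0 ≤ (G * Θ).trace + lam * offDiagNorm Θ := by
  simp only [offDiagNorm, trace, diag_apply, mul_apply, Finset.mul_sum, ← Finset.sum_add_distrib]
  refine Finset.sum_nonneg fun i _ => Finset.sum_nonneg fun j _ => ?_
  by_cases hij : i = j
  · subst hij; simp [h0]
  · have e : Θ j i = Θ i j := by rw [← transpose_apply Θ, hΘ]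
    rw [if_pos hij, e]
    have h1 : |G i j * Θ i j| ≤ lam * |Θ i j| := by
      rw [abs_mul]; exact mul_le_mul_of_nonneg_right (h i j) (abs_nonneg _)
    linarith [neg_abs_le (G i j * Θ i j)]

lemma transpose_eq_of_posDef {A : Matrix (Fin p) (Fin p) ℝ} (hA : A.PosDef) : Aᵀ = A := by
  simpa [IsHermitian, conjTranspose_eq_transpose_of_trivial] using hA.1

/-- The Karush-Kuhn-Tucker conditions, with `G = R - Θ⁻¹`, are sufficient for `Θ` to be the unique
minimizer of the graphical lasso objective. -/
lemma isGlassoMin_of_kkt {R Θ : Matrix (Fin p) (Fin p) ℝ} {lam : ℝ} (hΘ : Θ.PosDef)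
    (h0 : ∀ i, (R - Θ⁻¹) i i = 0) (h : ∀ i j, |(R - Θ⁻¹) i j| ≤ lam)
    (hs : ∀ i j, i ≠ j → (R - Θ⁻¹) i j * Θ i j = -(lam * |Θ i j|)) :
    IsGlassoMin R lam Θ ∧ ∀ Θ', IsGlassoMin R lam Θ' → Θ' = Θ := by
  have hG : ((R - Θ⁻¹) * Θ).trace + lam * offDiagNorm Θ = 0 := by
    simp only [offDiagNorm, trace, diag_apply, mul_apply, Finset.mul_sum,
      ← Finset.sum_add_distrib]
    refine Finset.sum_eq_zero fun i _ => Finset.sum_eq_zero fun j _ => ?_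
    by_cases hij : i = j
    · subst hij; simp only [h0]; simp
    · have e : Θ j i = Θ i j := by rw [← transpose_apply Θ, transpose_eq_of_posDef hΘ]
      rw [if_pos hij, e, hs i j hij]; ring
  have e1 : (Θ⁻¹ * Θ).trace = p := by
    rw [nonsing_inv_mul _ hΘ.det_pos.ne'.isUnit, trace_one, Fintype.card_fin]
  rw [Matrix.sub_mul, trace_sub, e1] at hG
  have key : ∀ Θ' : Matrix (Fin p) (Fin p) ℝ, Θ'.PosDef →
      (Θ⁻¹ * Θ').trace - p - (Real.log Θ'.det - Real.log Θ.det) ≤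
        glassoObj R lam Θ' - glassoObj R lam Θ := by
    intro Θ' hΘ'
    have h1 := trace_mul_add_nonneg (transpose_eq_of_posDef hΘ') h0 h
    rw [Matrix.sub_mul, trace_sub] at h1
    rw [glassoObj_eq, glassoObj_eq]
    linarith
  have key2 : ∀ Θ' : Matrix (Fin p) (Fin p) ℝ, Θ'.PosDef →
      0 ≤ (Θ⁻¹ * Θ').trace - p - (Real.log Θ'.det - Real.log Θ.det) := by
    intro Θ' hΘ'
    have := log_det_sub_le hΘ hΘ'
    rw [Fintype.card_fin] at this
    linarith
  refine ⟨⟨hΘ, fun Θ' hΘ' => by linarith [key Θ' hΘ', key2 Θ' hΘ']⟩, fun Θ' hΘ' => ?_⟩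
  have h1 := key Θ' hΘ'.1
  have h2 := key2 Θ' hΘ'.1
  have h3 := hΘ'.2 Θ hΘ
  apply eq_of_log_det_sub_eq hΘ hΘ'.1
  rw [Fintype.card_fin]
  linarith

lemma continuous_offDiagNorm : Continuous (offDiagNorm (p := p)) := by
  refine continuous_finsetSum _ fun i _ => continuous_finsetSum _ fun j _ => ?_
  split_ifs
  · exact (continuous_id.matrix_elem i j).abs
  · exact continuous_const

/-- The graphical lasso objective attains its minimum over the positive definite matrices in a
closed set `C`, provided some positive definite `S` is feasible for the dual problem: then the
objective dominates `-log det Θ + tr (S Θ)`, whose sublevel sets are compact. -/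
lemma exists_min_on_closed {R S : Matrix (Fin p) (Fin p) ℝ} {lam : ℝ} (hS : S.PosDef)
    (h0 : ∀ i, (R - S) i i = 0) (h : ∀ i j, |(R - S) i j| ≤ lam)
    {C : Set (Matrix (Fin p) (Fin p) ℝ)} (hC : IsClosed C) {Θ₀ : Matrix (Fin p) (Fin p) ℝ}
    (hΘ₀ : Θ₀.PosDef) (hΘ₀C : Θ₀ ∈ C) :
    ∃ Θ ∈ C, Θ.PosDef ∧ ∀ Θ' ∈ C, Θ'.PosDef → glassoObj R lam Θ ≤ glassoObj R lam Θ' := by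
  obtain ⟨B, hB, hSB⟩ := exists_factor hS
  have hBd : IsUnit B.det := (isUnit_iff_isUnit_det B).1 hB
  have hBt : IsUnit Bᵀ.det := by rwa [det_transpose]
  set f := glassoObj R lam with hf
  have hlow : ∀ Θ : Matrix (Fin p) (Fin p) ℝ, Θ.PosDef →
      -Real.log Θ.det + (S * Θ).trace ≤ f Θ := by
    intro Θ hΘ
    have h1 := trace_mul_add_nonneg (transpose_eq_of_posDef hΘ) h0 h
    rw [Matrix.sub_mul, trace_sub] at h1
    rw [hf, glassoObj_eq]
    linarith
  have htr : ∀ Θ : Matrix (Fin p) (Fin p) ℝ, (B * Θ * Bᵀ).trace = (S * Θ).trace := by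
    intro Θ
    rw [hSB, trace_mul_comm, ← Matrix.mul_assoc]
  -- The sublevel set of `f` at `Θ₀` lies in a set that is bounded in the coordinates `B Θ Bᵀ`
  -- and on which the determinant stays away from zero.
  obtain ⟨c, hc⟩ : ∃ c : ℝ, ∀ Θ : Matrix (Fin p) (Fin p) ℝ, Θ.PosDef → f Θ ≤ f Θ₀ →
      (B * Θ * Bᵀ).trace ≤ c := by
    refine ⟨2 * (f Θ₀ - Real.log S.det + p * Real.log 2 - p), fun Θ hΘ hle => ?_⟩
    have hN : ((2⁻¹ : ℝ) • (B * Θ * Bᵀ)).PosDef := (posDef_congr hΘ hB).smul (by norm_num)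
    have h1 := log_det_le_trace_sub_card hN
    have hd : (B * Θ * Bᵀ).det = S.det * Θ.det := by
      rw [hSB, det_mul, det_mul, det_mul]; ring
    rw [det_smul, trace_smul, Fintype.card_fin, hd, Real.log_mul (by positivity)
      (mul_pos hS.det_pos hΘ.det_pos).ne', Real.log_mul hS.det_pos.ne' hΘ.det_pos.ne',
      Real.log_pow, Real.log_inv, smul_eq_mul, htr] at h1
    have h2 := hlow Θ hΘ
    rw [htr]
    linarith
  have hdet : ∀ Θ : Matrix (Fin p) (Fin p) ℝ, Θ.PosDef → f Θ ≤ f Θ₀ →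
      Real.exp (-f Θ₀) ≤ Θ.det := by
    intro Θ hΘ hle
    have h2 := hlow Θ hΘ
    have h3 : 0 ≤ (S * Θ).trace := by
      rw [← htr]; exact (posDef_congr hΘ hB).posSemidef.trace_nonneg
    rw [← Real.le_log_iff_exp_le hΘ.det_pos]
    linarith
  set g : Matrix (Fin p) (Fin p) ℝ → Matrix (Fin p) (Fin p) ℝ := fun N => B⁻¹ * N * Bᵀ⁻¹ with hg
  have hgc : Continuous g := by fun_prop
  have hgB : ∀ Θ, g (B * Θ * Bᵀ) = Θ := by
    intro Θ
    simp only [hg]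
    rw [← Matrix.mul_assoc, ← Matrix.mul_assoc, nonsing_inv_mul _ hBd, Matrix.one_mul,
      Matrix.mul_assoc, mul_nonsing_inv _ hBt, Matrix.mul_one]
  have hcomp : IsCompact (g '' {N | ∀ i j, N i j ∈ Set.Icc (-c) c}) := by
    refine IsCompact.image ?_ hgc
    have := isCompact_univ_pi (X := fun _ : Fin p => Fin p → ℝ) (s := fun _ => Set.univ.pi
      fun _ : Fin p => Set.Icc (-c) c) fun _ => isCompact_univ_pi fun _ => isCompact_Icc
    have e : {N : Fin p → Fin p → ℝ | ∀ i j, N i j ∈ Set.Icc (-c) c} = Set.univ.pi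
        fun _ : Fin p => Set.univ.pi fun _ : Fin p => Set.Icc (-c) c := by
      ext N
      simp only [Set.mem_ofPred_eq, Set.mem_pi, Set.mem_univ, true_imp_iff]
    rw [← e] at this
    exact this
  set K := g '' {N | ∀ i j, N i j ∈ Set.Icc (-c) c} ∩
    (C ∩ ({Θ | Θ.PosSemidef} ∩ {Θ | Real.exp (-f Θ₀) ≤ Θ.det})) with hK
  have hKc : IsCompact K := hcomp.inter_right
    (hC.inter (isClosed_posSemidef.inter (isClosed_le continuous_const (by fun_prop))))
  have hmem : ∀ Θ ∈ C, Θ.PosDef → f Θ ≤ f Θ₀ → Θ ∈ K := by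
    intro Θ hΘC hΘ hle
    refine ⟨⟨B * Θ * Bᵀ, fun i j => ?_, hgB Θ⟩, hΘC, hΘ.posSemidef, hdet Θ hΘ hle⟩
    exact abs_le.1 ((abs_apply_le_trace (posDef_congr hΘ hB).posSemidef i j).trans (hc Θ hΘ hle))
  have hfc : ContinuousOn f K := by
    intro Θ hΘ
    have hpos : Θ.det ≠ 0 := ((Real.exp_pos _).trans_le hΘ.2.2.2).ne'
    have h1 : ContinuousAt (fun Θ : Matrix (Fin p) (Fin p) ℝ => Real.log Θ.det) Θ :=
      (Continuous.matrix_det continuous_id).continuousAt.log hpos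
    have h2 : Continuous fun Θ : Matrix (Fin p) (Fin p) ℝ => (R * Θ).trace := by fun_prop
    exact ((h1.neg.add h2.continuousAt).add
      (continuous_const.mul continuous_offDiagNorm).continuousAt).continuousWithinAt
  obtain ⟨Θ, hΘK, hmin⟩ := hKc.exists_isMinOn ⟨Θ₀, hmem Θ₀ hΘ₀C hΘ₀ le_rfl⟩ hfc
  have hΘpd : Θ.PosDef :=
    hΘK.2.2.1.posDef_iff_det_ne_zero.2 ((Real.exp_pos _).trans_le hΘK.2.2.2).ne'
  refine ⟨Θ, hΘK.2.1, hΘpd, fun Θ' hΘ'C hΘ' => ?_⟩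
  rcases le_total (f Θ') (f Θ₀) with hle | hle
  · exact hmin (hmem Θ' hΘ'C hΘ' hle)
  · exact (hmin (hmem Θ₀ hΘ₀C hΘ₀ le_rfl)).trans hle

lemma offDiagNorm_convex (Θ Φ : Matrix (Fin p) (Fin p) ℝ) {t : ℝ} (h0 : 0 ≤ t) (h1 : t ≤ 1) :
    offDiagNorm (Θ + t • (Φ - Θ)) ≤ offDiagNorm Θ + t * (offDiagNorm Φ - offDiagNorm Θ) := by
  simp only [offDiagNorm, Finset.mul_sum, ← Finset.sum_add_distrib, ← Finset.sum_sub_distrib]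
  refine Finset.sum_le_sum fun i _ => Finset.sum_le_sum fun j _ => ?_
  split_ifs
  · have : (Θ + t • (Φ - Θ)) i j = (1 - t) * Θ i j + t * Φ i j := by
      simp; ring
    rw [this]
    refine (abs_add_le _ _).trans ?_
    rw [abs_mul, abs_mul, abs_of_nonneg h0, abs_of_nonneg (sub_nonneg.2 h1)]
    linarith
  · simp

/-- The variational inequality satisfied by a minimizer over a convex set of positive definite
matrices. -/
lemma variational_inequality {R Θ Φ : Matrix (Fin p) (Fin p) ℝ} {lam : ℝ} (hlam : 0 ≤ lam)
    (hΘ : Θ.PosDef) (hΦ : Φᵀ = Φ)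
    (hmin : ∀ t : ℝ, (Θ + t • (Φ - Θ)).PosDef →
      glassoObj R lam Θ ≤ glassoObj R lam (Θ + t • (Φ - Θ))) :
    0 ≤ ((R - Θ⁻¹) * (Φ - Θ)).trace + lam * (offDiagNorm Φ - offDiagNorm Θ) := by
  set E := Φ - Θ with hE
  have hEt : Eᵀ = E := by rw [hE, transpose_sub, hΦ, transpose_eq_of_posDef hΘ]
  set φ : ℝ → ℝ := fun t => ((R - (Θ + t • E)⁻¹) * E).trace +
    lam * (offDiagNorm Φ - offDiagNorm Θ) with hφ
  have hcont : ContinuousAt φ 0 := by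
    have h1 : ContinuousAt (fun t : ℝ => (Θ + t • E)⁻¹) 0 := by
      simp only [inv_def, Ring.inverse_eq_inv']
      have hc : Continuous fun t : ℝ => Θ + t • E := by fun_prop
      refine ContinuousAt.smul (ContinuousAt.inv₀ hc.matrix_det.continuousAt ?_)
        hc.matrix_adjugate.continuousAt
      simpa using hΘ.det_pos.ne'
    have h2 : Continuous fun M : Matrix (Fin p) (Fin p) ℝ => ((R - M) * E).trace +
      lam * (offDiagNorm Φ - offDiagNorm Θ) := by fun_prop
    exact ContinuousAt.comp (g := fun M : Matrix (Fin p) (Fin p) ℝ => ((R - M) * E).trace +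
      lam * (offDiagNorm Φ - offDiagNorm Θ)) h2.continuousAt h1
  have h0 : φ 0 = ((R - Θ⁻¹) * E).trace + lam * (offDiagNorm Φ - offDiagNorm Θ) := by
    simp [hφ]
  rw [← h0]
  refine ge_of_tendsto (hcont.tendsto.mono_left (nhdsWithin_le_nhds (s := Set.Ioi 0))) ?_
  set K := linfNorm (Θ⁻¹ * E) with hK
  have hK0 : 0 ≤ K := linfNorm_nonneg _
  have hev : ∀ᶠ t : ℝ in nhdsWithin 0 (Set.Ioi 0), t ∈ Set.Ioo 0 (1 / (K + 1)) :=
    Ioo_mem_nhdsGT (by positivity)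
  filter_upwards [hev] with t ht
  have ht0 : 0 < t := ht.1
  have htK : t * (K + 1) < 1 := by
    have := ht.2; rwa [lt_div_iff₀ (by positivity)] at this
  have ht1 : t ≤ 1 := by nlinarith
  have hpd : (Θ + t • E).PosDef := by
    have := posDef_inv_add (E := t • E) hΘ.inv (by rw [transpose_smul, hEt]) (by
      rw [Matrix.mul_smul, linfNorm_smul, abs_of_pos ht0]; nlinarith)
    rwa [nonsing_inv_nonsing_inv _ hΘ.det_pos.ne'.isUnit] at this
  have h1 := hmin t hpd
  have h2 := offDiagNorm_convex Θ Φ ht0.le ht1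
  have h3 := log_det_sub_le hpd hΘ
  have h4 : ((Θ + t • E)⁻¹ * Θ).trace = p - t * ((Θ + t • E)⁻¹ * E).trace := by
    have : ((Θ + t • E)⁻¹ * (Θ + t • E)).trace = p := by
      rw [nonsing_inv_mul _ hpd.det_pos.ne'.isUnit, trace_one, Fintype.card_fin]
    rw [Matrix.mul_add, trace_add, Matrix.mul_smul, trace_smul, smul_eq_mul] at this
    linarith
  rw [h4, Fintype.card_fin] at h3
  rw [glassoObj_eq, glassoObj_eq, Matrix.mul_add, trace_add, Matrix.mul_smul, trace_smul,
    smul_eq_mul] at h1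
  have h5 : 0 ≤ t * φ t := by
    have h6 := mul_le_mul_of_nonneg_left h2 hlam
    simp only [hφ, Matrix.sub_mul, trace_sub]
    nlinarith
  exact nonneg_of_mul_nonneg_right h5 ht0

end Optimality

/-! ### Restricted minimizers and the remainder of matrix inversion -/

section Restricted

variable {p : ℕ}

lemma sum_single (i j : Fin p) (x : ℝ) : ∑ a, ∑ b, single i j x a b = x := by
  simp [single_apply, ite_and]

/-- The Karush-Kuhn-Tucker conditions hold on the support of `T` at a minimizer of the objective
among the positive definite matrices supported there. -/
lemma kkt_of_restricted_min {R T Θ : Matrix (Fin p) (Fin p) ℝ} {lam : ℝ} (hlam : 0 ≤ lam)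
    (hR : Rᵀ = R) (hT : Tᵀ = T) (hΘ : Θ.PosDef) (hΘT : ∀ i j, T i j = 0 → Θ i j = 0)
    (hmin : ∀ Θ' : Matrix (Fin p) (Fin p) ℝ, (∀ i j, T i j = 0 → Θ' i j = 0) → Θ'.PosDef →
      glassoObj R lam Θ ≤ glassoObj R lam Θ') :
    (∀ i, T i i ≠ 0 → (R - Θ⁻¹) i i = 0) ∧
    ∀ i j, i ≠ j → T i j ≠ 0 →
      |(R - Θ⁻¹) i j| ≤ lam ∧ (R - Θ⁻¹) i j * Θ i j = -(lam * |Θ i j|) := by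
  have hΘt := transpose_eq_of_posDef hΘ
  set G := R - Θ⁻¹ with hG
  have hGt : Gᵀ = G := by rw [hG, transpose_sub, hR, transpose_nonsing_inv, hΘt]
  have hvi : ∀ E : Matrix (Fin p) (Fin p) ℝ, Eᵀ = E → (∀ i j, T i j = 0 → E i j = 0) →
      0 ≤ (G * E).trace + lam * (offDiagNorm (Θ + E) - offDiagNorm Θ) := by
    intro E hE hET
    have := variational_inequality (R := R) (Φ := Θ + E) hlam hΘ
      (by rw [transpose_add, hΘt, hE]) (fun t ht => hmin _ (fun i j hij => by
        simp [hΘT i j hij, hET i j hij]) ht)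
    rwa [add_sub_cancel_left] at this
  constructor
  · intro i hi
    have key : ∀ s : ℝ, 0 ≤ s * G i i := by
      intro s
      have h1 := hvi (single i i s) (by rw [transpose_single]) (fun a b hab => by
        rw [single_apply, if_neg]
        rintro ⟨rfl, rfl⟩
        exact hi hab)
      have h2 : offDiagNorm (Θ + single i i s) = offDiagNorm Θ := by
        refine Finset.sum_congr rfl fun a _ => Finset.sum_congr rfl fun b _ => ?_
        split_ifs with hab
        · rw [Matrix.add_apply, single_apply, if_neg, add_zero]
          rintro ⟨rfl, rfl⟩
          exact hab rfl
        · rfl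
      rw [h2, trace_mul_single] at h1
      simpa [mul_comm] using h1
    have h1 := key 1
    have h2 := key (-1)
    linarith
  · intro i j hij hTij
    have hTji : T j i ≠ 0 := by rwa [← transpose_apply T, hT]
    have key : ∀ s : ℝ, 0 ≤ s * G i j + lam * (|Θ i j + s| - |Θ i j|) := by
      intro s
      have h1 := hvi (single i j s + single j i s)
        (by rw [transpose_add, transpose_single, transpose_single, add_comm])
        (fun a b hab => by
          rw [Matrix.add_apply, single_apply, single_apply, if_neg, if_neg, add_zero]
          · rintro ⟨rfl, rfl⟩
            exact hTji hab
          · rintro ⟨rfl, rfl⟩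
            exact hTij hab)
      have h2 : offDiagNorm (Θ + (single i j s + single j i s)) - offDiagNorm Θ =
          2 * (|Θ i j + s| - |Θ i j|) := by
        have hΘji : Θ j i = Θ i j := by rw [← transpose_apply Θ, hΘt]
        simp only [offDiagNorm, ← Finset.sum_sub_distrib]
        have : ∀ a b, ((if a ≠ b then |(Θ + (single i j s + single j i s)) a b| else 0) -
            (if a ≠ b then |Θ a b| else 0) : ℝ) =
            single i j (|Θ i j + s| - |Θ i j|) a b + single j i (|Θ i j + s| - |Θ i j|) a b := by
          intro a b
          simp only [Matrix.add_apply, single_apply]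
          by_cases h1 : i = a ∧ j = b
          · obtain ⟨rfl, rfl⟩ := h1
            simp [hij, hij.symm]
          · by_cases h2 : j = a ∧ i = b
            · obtain ⟨rfl, rfl⟩ := h2
              simp [hij, hij.symm, hΘji]
            · simp [h1, h2]
        refine (Finset.sum_congr rfl fun a _ => Finset.sum_congr rfl fun b _ => this a b).trans ?_
        simp_rw [Finset.sum_add_distrib, sum_single]
        ring
      have hGji : G j i = G i j := by rw [← transpose_apply G, hGt]
      rw [h2, Matrix.mul_add, trace_add, trace_mul_single, trace_mul_single, hGji] at h1
      simp only [op_smul_eq_smul, smul_eq_mul] at h1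
      linarith
    have hb : |G i j| ≤ lam := by
      have h1 := key 1
      have h2 := key (-1)
      have a1 : |Θ i j + 1| - |Θ i j| ≤ 1 := by
        have := abs_add_le (Θ i j) 1; rw [abs_one] at this; linarith
      have a2 : |Θ i j + -1| - |Θ i j| ≤ 1 := by
        have := abs_add_le (Θ i j) (-1); rw [abs_neg, abs_one] at this; linarith
      have b1 := mul_le_mul_of_nonneg_left a1 hlam
      have b2 := mul_le_mul_of_nonneg_left a2 hlam
      rw [abs_le]; constructor <;> linarith
    refine ⟨hb, le_antisymm ?_ ?_⟩
    · have := key (-Θ i j)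
      simp only [add_neg_cancel, abs_zero] at this
      linarith
    · have h1 : |G i j * Θ i j| ≤ lam * |Θ i j| := by
        rw [abs_mul]; exact mul_le_mul_of_nonneg_right hb (abs_nonneg _)
      linarith [neg_abs_le (G i j * Θ i j)]

end Restricted

section Remainder

variable {ι : Type*} [Fintype ι] [DecidableEq ι]

/-- The second order remainder of matrix inversion at `S⁻¹` in the direction `Δ`. -/
noncomputable def invRem (S Δ : Matrix ι ι ℝ) : Matrix ι ι ℝ := (S⁻¹ + Δ)⁻¹ - S + S * Δ * S

variable {S Δ Δ' : Matrix ι ι ℝ} {q : ℝ}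

lemma linfNorm_sub_inv_le (hS : IsUnit S.det) (h : linfNorm (S * Δ) ≤ q) (hq : q ≤ 1 / 8) :
    linfNorm (S - (S⁻¹ + Δ)⁻¹) ≤ 8 / 7 * q * linfNorm S := by
  have hK := linfNorm_nonneg S
  have hq0 : 0 ≤ q := (linfNorm_nonneg _).trans h
  have hP := linfNorm_inv_add_inv_le hS h (by linarith)
  rw [sub_inv_add_inv hS (isUnit_det_inv_add hS (by linarith))]
  calc _ ≤ q * (linfNorm S / (1 - q)) :=
        (linfNorm_mul_le _ _).trans (mul_le_mul h hP (linfNorm_nonneg _) hq0)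
    _ ≤ q * (8 / 7 * linfNorm S) := by
        refine mul_le_mul_of_nonneg_left ?_ hq0
        rw [div_le_iff₀ (by linarith)]
        nlinarith
    _ = _ := by ring

lemma linfNorm_inv_le (hS : IsUnit S.det) (h : linfNorm (S * Δ) ≤ q) (hq : q ≤ 1 / 8) :
    linfNorm (S⁻¹ + Δ)⁻¹ ≤ 8 / 7 * linfNorm S := by
  have hK := linfNorm_nonneg S
  refine (linfNorm_inv_add_inv_le hS h (by linarith)).trans ?_
  rw [div_le_iff₀ (by linarith)]
  nlinarith

lemma transpose_sub_inv (hSt : Sᵀ = S) :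
    (S - (S⁻¹ + Δ)⁻¹)ᵀ = S - (S⁻¹ + Δᵀ)⁻¹ := by
  rw [transpose_sub, transpose_nonsing_inv, transpose_add, transpose_nonsing_inv, hSt]

/-- Entrywise bound on the remainder; `c` bounds the entries of `Δ` and `q` the norms of `S Δ`
and `S Δᵀ`. -/
lemma abs_invRem_le (hS : IsUnit S.det) (hSt : Sᵀ = S) (h : linfNorm (S * Δ) ≤ q)
    (h' : linfNorm (S * Δᵀ) ≤ q) (hq : q ≤ 1 / 8) {c : ℝ} (hc0 : 0 ≤ c)
    (hc : ∀ i j, |Δ i j| ≤ c) (i j : ι) :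
    |invRem S Δ i j| ≤ 8 / 7 * linfNorm S ^ 2 * q * c := by
  have hu := isUnit_det_inv_add hS (E := Δ) (h.trans_lt (by linarith))
  have e : invRem S Δ = S * Δ * (S - (S⁻¹ + Δ)⁻¹) := by
    rw [invRem, Matrix.mul_sub, ← sub_inv_add_inv hS hu]; abel
  have hK := linfNorm_nonneg S
  rw [e]
  calc _ ≤ linfNorm S * c * linfNorm (S - (S⁻¹ + Δ)⁻¹)ᵀ :=
        abs_mul_apply_le' _ _ (abs_mul_apply_le S Δ hc hc0) (mul_nonneg hK hc0) i j
    _ ≤ linfNorm S * c * (8 / 7 * q * linfNorm S) := by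
        refine mul_le_mul_of_nonneg_left ?_ (mul_nonneg hK hc0)
        rw [transpose_sub_inv hSt]
        exact linfNorm_sub_inv_le hS h' hq
    _ = _ := by ring

lemma abs_invRem_sub_le (hS : IsUnit S.det) (hSt : Sᵀ = S) (h : linfNorm (S * Δ) ≤ q)
    (h2 : linfNorm (S * Δ') ≤ q) (h2' : linfNorm (S * Δ'ᵀ) ≤ q) (hq : q ≤ 1 / 8)
    {c : ℝ} (hc0 : 0 ≤ c) (hc : ∀ i j, |Δ i j - Δ' i j| ≤ c) (i j : ι) :
    |invRem S Δ i j - invRem S Δ' i j| ≤ 120 / 49 * linfNorm S ^ 2 * q * c := by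
  have hu := isUnit_det_inv_add hS (E := Δ) (h.trans_lt (by linarith))
  have hu' := isUnit_det_inv_add hS (E := Δ') (h2.trans_lt (by linarith))
  set P := (S⁻¹ + Δ)⁻¹ with hP
  set P' := (S⁻¹ + Δ')⁻¹ with hP'
  have hPP : P * (Δ - Δ') * P' = P' - P := by
    have e1 : P * (S⁻¹ + Δ) = 1 := nonsing_inv_mul _ hu
    have e2 : (S⁻¹ + Δ') * P' = 1 := mul_nonsing_inv _ hu'
    have : Δ - Δ' = (S⁻¹ + Δ) - (S⁻¹ + Δ') := by abel
    rw [this, Matrix.mul_sub, Matrix.sub_mul, e1, Matrix.one_mul, Matrix.mul_assoc, e2,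
      Matrix.mul_one]
  have e : invRem S Δ - invRem S Δ' =
      (S - P) * (Δ - Δ') * S + P * (Δ - Δ') * (S - P') := by
    have : (S - P) * (Δ - Δ') * S + P * (Δ - Δ') * (S - P') =
        S * (Δ - Δ') * S - P * (Δ - Δ') * P' := by noncomm_ring
    rw [this, hPP, invRem, invRem, ← hP, ← hP']
    noncomm_ring
  have hq0 : 0 ≤ q := (linfNorm_nonneg _).trans h
  have hK := linfNorm_nonneg S
  have b1 : |((S - P) * (Δ - Δ') * S) i j| ≤ (8 / 7 * q * linfNorm S) * c * linfNorm S := by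
    have hX := linfNorm_sub_inv_le hS h hq
    have := abs_mul_apply_le' ((S - P) * (Δ - Δ')) S
      (abs_mul_apply_le (S - P) (Δ - Δ') hc hc0) (mul_nonneg (linfNorm_nonneg _) hc0) i j
    rw [hSt] at this
    exact this.trans (mul_le_mul_of_nonneg_right (mul_le_mul_of_nonneg_right hX hc0) hK)
  have b2 : |(P * (Δ - Δ') * (S - P')) i j| ≤
      (8 / 7 * linfNorm S) * c * (8 / 7 * q * linfNorm S) := by
    have hX := linfNorm_inv_le hS h hq
    have hY := linfNorm_sub_inv_le hS h2' hq
    rw [← transpose_sub_inv hSt] at hY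
    have := abs_mul_apply_le' (P * (Δ - Δ')) (S - P')
      (abs_mul_apply_le P (Δ - Δ') hc hc0) (mul_nonneg (linfNorm_nonneg _) hc0) i j
    exact this.trans (mul_le_mul (mul_le_mul_of_nonneg_right hX hc0) hY (linfNorm_nonneg _)
      (by positivity))
  have e' := congrFun (congrFun e i) j
  rw [Matrix.sub_apply] at e'
  rw [e', Matrix.add_apply]
  refine (abs_add_le _ _).trans ((add_le_add b1 b2).trans (le_of_eq ?_))
  ring

end Remainder

/-! ### Prescribing the inverse on the support -/

section FixedPoint

variable {p : ℕ}

open Classical in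
/-- The matrix with entries `δ` on the support of `T` and zero elsewhere. -/
noncomputable def ofSupp (T : Matrix (Fin p) (Fin p) ℝ) (δ : {e // supp T e} → ℝ) :
    Matrix (Fin p) (Fin p) ℝ :=
  of fun i j => if h : supp T (i, j) then δ ⟨(i, j), h⟩ else 0

lemma ofSupp_apply_coe {T : Matrix (Fin p) (Fin p) ℝ} (δ : {e // supp T e} → ℝ)
    (e : {e // supp T e}) : ofSupp T δ e.1.1 e.1.2 = δ e := by
  simp only [ofSupp, of_apply]
  rw [dif_pos e.2]

lemma ofSupp_apply_of_eq_zero {T : Matrix (Fin p) (Fin p) ℝ} (δ : {e // supp T e} → ℝ)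
    {i j : Fin p} (h : T i j = 0) : ofSupp T δ i j = 0 := by
  simp only [ofSupp, of_apply]
  rw [dif_neg (fun h' => h' h)]

lemma ofSupp_restrict {T M : Matrix (Fin p) (Fin p) ℝ} (h : ∀ i j, T i j = 0 → M i j = 0) :
    ofSupp T (fun e => M e.1.1 e.1.2) = M := by
  ext i j
  by_cases hT : T i j = 0
  · rw [ofSupp_apply_of_eq_zero _ hT, h i j hT]
  · exact ofSupp_apply_coe (T := T) (fun e => M e.1.1 e.1.2) ⟨(i, j), hT⟩

lemma ofSupp_zero (T : Matrix (Fin p) (Fin p) ℝ) : ofSupp T 0 = 0 := by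
  ext i j
  simp [ofSupp]

open Classical in
lemma abs_ofSupp_sub_le {T : Matrix (Fin p) (Fin p) ℝ} (δ δ' : {e // supp T e} → ℝ)
    (i j : Fin p) : |ofSupp T δ i j - ofSupp T δ' i j| ≤ dist δ δ' := by
  by_cases hT : T i j = 0
  · rw [ofSupp_apply_of_eq_zero _ hT, ofSupp_apply_of_eq_zero _ hT]
    simp
  · have e1 := ofSupp_apply_coe δ ⟨(i, j), hT⟩
    have e2 := ofSupp_apply_coe δ' ⟨(i, j), hT⟩
    simp only at e1 e2
    rw [e1, e2, ← Real.dist_eq]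
    exact dist_le_pi_dist δ δ' _

open Classical in
lemma abs_ofSupp_le {T : Matrix (Fin p) (Fin p) ℝ} (δ : {e // supp T e} → ℝ)
    (i j : Fin p) : |ofSupp T δ i j| ≤ ‖δ‖ := by
  simpa [ofSupp_zero] using abs_ofSupp_sub_le δ 0 i j

open Classical in
/-- The action of `S ⊗ S` on matrices supported on the support of `T`. -/
lemma sum_hess_mul {S T : Matrix (Fin p) (Fin p) ℝ} (hSt : Sᵀ = S) (δ : {e // supp T e} → ℝ)
    (e : Fin p × Fin p) :
    ∑ e' : {e // supp T e}, hess S e e'.1 * δ e' = (S * ofSupp T δ * S) e.1 e.2 := by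
  have h1 : ∀ e' : {e // supp T e}, hess S e e'.1 * δ e' =
      hess S e e'.1 * ofSupp T δ e'.1.1 e'.1.2 := fun e' => by rw [ofSupp_apply_coe]
  rw [Finset.sum_congr rfl fun e' _ => h1 e']
  have h2 : ∑ e' : {e // supp T e}, hess S e e'.1 * ofSupp T δ e'.1.1 e'.1.2 =
      ∑ e' : Fin p × Fin p, hess S e e' * ofSupp T δ e'.1 e'.2 := by
    rw [← Finset.sum_subtype (p := supp T) (Finset.univ.filter (supp T)) (by simp)
      (fun e' => hess S e e' * ofSupp T δ e'.1 e'.2)]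
    refine Finset.sum_filter_of_ne fun e' _ hne h0 => hne ?_
    rw [ofSupp_apply_of_eq_zero δ h0, mul_zero]
  rw [h2, Fintype.sum_prod_type]
  simp only [mul_apply, Finset.sum_mul, hess, kroneckerMap_apply]
  rw [Finset.sum_comm]
  refine Finset.sum_congr rfl fun k _ => Finset.sum_congr rfl fun l _ => ?_
  have : S k e.2 = S e.2 k := by rw [← transpose_apply S, hSt]
  rw [this]; ring

lemma posDef_hess_block {S : Matrix (Fin p) (Fin p) ℝ} (hS : S.PosDef) :
    ((hess S).toBlock (supp S⁻¹) (supp S⁻¹)).PosDef :=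
  (hS.kronecker hS).submatrix Subtype.val_injective

open Classical in
lemma hessSSInv_mulVec {S : Matrix (Fin p) (Fin p) ℝ} (hS : S.PosDef)
    (δ : {e // supp S⁻¹ e} → ℝ) :
    hessSSInv S *ᵥ (fun e => (S * ofSupp S⁻¹ δ * S) e.1.1 e.1.2) = δ := by
  have h1 : (fun e : {e // supp S⁻¹ e} => (S * ofSupp S⁻¹ δ * S) e.1.1 e.1.2) =
      (hess S).toBlock (supp S⁻¹) (supp S⁻¹) *ᵥ δ := by
    ext e
    rw [← sum_hess_mul (transpose_eq_of_posDef hS)]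
    rfl
  rw [h1, mulVec_mulVec, hessSSInv, nonsing_inv_mul _ (posDef_hess_block hS).det_pos.ne'.isUnit,
    one_mulVec]

open Classical in
lemma hessSSInv_mulVec_eq_zero {S : Matrix (Fin p) (Fin p) ℝ} (hS : S.PosDef)
    {v : {e // supp S⁻¹ e} → ℝ} (h : hessSSInv S *ᵥ v = 0) : v = 0 := by
  have h1 : (hess S).toBlock (supp S⁻¹) (supp S⁻¹) *ᵥ (hessSSInv S *ᵥ v) = v := by
    rw [mulVec_mulVec, hessSSInv, mul_nonsing_inv _ (posDef_hess_block hS).det_pos.ne'.isUnit,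
      one_mulVec]
  rw [← h1, h, mulVec_zero]

open Classical in
lemma KH_nonneg (S : Matrix (Fin p) (Fin p) ℝ) : 0 ≤ KH S := linfNorm_nonneg _

open Classical in
lemma linfNorm_le_of_support {T Δ : Matrix (Fin p) (Fin p) ℝ} {D ρ : ℝ} (hρ : 0 ≤ ρ) (hD0 : 0 ≤ D)
    (hD : ∀ i, ((Finset.univ.filter fun j => T i j ≠ 0).card : ℝ) ≤ D)
    (hΔ : ∀ i j, T i j = 0 → Δ i j = 0) (hΔρ : ∀ i j, |Δ i j| ≤ ρ) : linfNorm Δ ≤ D * ρ := by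
  refine linfNorm_le (mul_nonneg hD0 hρ) fun i => ?_
  calc ∑ j, |Δ i j| ≤ ∑ j, if T i j ≠ 0 then ρ else 0 := by
        refine Finset.sum_le_sum fun j _ => ?_
        split_ifs with h
        · exact hΔρ i j
        · rw [hΔ i j (not_not.1 h), abs_zero]
    _ = ((Finset.univ.filter fun j => T i j ≠ 0).card : ℝ) * ρ := by
        rw [← Finset.sum_filter, Finset.sum_const, nsmul_eq_mul]
    _ ≤ _ := mul_le_mul_of_nonneg_right (hD i) hρ

open Classical in
/-- The equation `((S⁻¹ + Δ)⁻¹)_A = b_A`, with `A` the support of `S⁻¹`, has a solution `Δ`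
supported on `A` in the `ρ`-ball of the maximum norm when `b` is close to `S`: it is the fixed
point of a contraction, a Newton step frozen at `S⁻¹`. -/
lemma exists_inv_eq_on_support {S b : Matrix (Fin p) (Fin p) ℝ} {D ρ w : ℝ} (hS : S.PosDef)
    (hb : bᵀ = b) (hρ : 0 ≤ ρ) (hD0 : 0 ≤ D) (hw0 : 0 ≤ w)
    (hD : ∀ i, ((Finset.univ.filter fun j => S⁻¹ i j ≠ 0).card : ℝ) ≤ D)
    (hq : linfNorm S * (D * ρ) ≤ 1 / 8)
    (hq2 : KH S * linfNorm S ^ 2 * (linfNorm S * (D * ρ)) ≤ 1 / 8)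
    (hw : KH S * w ≤ 6 / 7 * ρ)
    (hbw : ∀ i j, S⁻¹ i j ≠ 0 → |b i j - S i j| ≤ w) :
    ∃ Δ : Matrix (Fin p) (Fin p) ℝ, Δᵀ = Δ ∧ (∀ i j, S⁻¹ i j = 0 → Δ i j = 0) ∧
      (∀ i j, |Δ i j| ≤ ρ) ∧ ∀ i j, S⁻¹ i j ≠ 0 → (S⁻¹ + Δ)⁻¹ i j = b i j := by
  have hSt := transpose_eq_of_posDef hS
  have hSu : IsUnit S.det := hS.det_pos.ne'.isUnit
  have hTt : S⁻¹ᵀ = S⁻¹ := by rw [transpose_nonsing_inv, hSt]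
  have hK := linfNorm_nonneg S
  have hKH := KH_nonneg S
  set q := linfNorm S * (D * ρ) with hqdef
  have hq0 : 0 ≤ q := by positivity
  set A := {e // supp S⁻¹ e} with hA
  set M : (A → ℝ) → Matrix (Fin p) (Fin p) ℝ := ofSupp S⁻¹ with hM
  have hMq : ∀ δ : A → ℝ, ‖δ‖ ≤ ρ → linfNorm (S * M δ) ≤ q ∧ linfNorm (S * (M δ)ᵀ) ≤ q := by
    intro δ hδ
    have hz : ∀ i j, S⁻¹ i j = 0 → M δ i j = 0 := fun i j h => ofSupp_apply_of_eq_zero δ h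
    have hb : ∀ i j, |M δ i j| ≤ ρ := fun i j => (abs_ofSupp_le δ i j).trans hδ
    constructor
    · exact (linfNorm_mul_le _ _).trans
        (mul_le_mul_of_nonneg_left (linfNorm_le_of_support hρ hD0 hD hz hb) hK)
    · refine (linfNorm_mul_le _ _).trans
        (mul_le_mul_of_nonneg_left (linfNorm_le_of_support hρ hD0 hD (fun i j h => ?_)
          (fun i j => hb j i)) hK)
      exact hz j i (by rwa [← transpose_apply S⁻¹, hTt])
  set Φ : (A → ℝ) → (A → ℝ) := fun δ =>
    δ + hessSSInv S *ᵥ (fun e => (S⁻¹ + M δ)⁻¹ e.1.1 e.1.2 - b e.1.1 e.1.2) with hΦ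
  have hΦrem : ∀ δ, Φ δ = hessSSInv S *ᵥ
      (fun e => invRem S (M δ) e.1.1 e.1.2 - (b e.1.1 e.1.2 - S e.1.1 e.1.2)) := by
    intro δ
    have h1 := hessSSInv_mulVec hS δ
    have h2 : (fun e : A => invRem S (M δ) e.1.1 e.1.2 - (b e.1.1 e.1.2 - S e.1.1 e.1.2)) =
        (fun e : A => (S * M δ * S) e.1.1 e.1.2) +
        (fun e : A => (S⁻¹ + M δ)⁻¹ e.1.1 e.1.2 - b e.1.1 e.1.2) := by
      ext e
      simp only [invRem, Matrix.add_apply, Matrix.sub_apply, Pi.add_apply]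
      ring
    rw [h2, mulVec_add, h1]
  -- The remainder uses up `1 / 7` of the radius, which leaves `6 / 7` for `b - S`.
  have hmaps : Set.MapsTo Φ (Metric.closedBall 0 ρ) (Metric.closedBall 0 ρ) := by
    intro δ hδ
    rw [mem_closedBall_zero_iff] at hδ ⊢
    obtain ⟨h1, h2⟩ := hMq δ hδ
    rw [pi_norm_le_iff_of_nonneg hρ]
    intro e
    rw [hΦrem, Real.norm_eq_abs]
    have hv : ∀ e : A, |invRem S (M δ) e.1.1 e.1.2 - (b e.1.1 e.1.2 - S e.1.1 e.1.2)| ≤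
        8 / 7 * linfNorm S ^ 2 * q * ρ + w := by
      intro e
      refine (abs_sub _ _).trans (add_le_add ?_ (hbw _ _ e.2))
      exact abs_invRem_le hSu hSt h1 h2 hq hρ (fun i j => (abs_ofSupp_le δ i j).trans hδ) _ _
    refine (abs_sum_mul_le (hessSSInv S) _ hv (by positivity) e).trans ?_
    change KH S * _ ≤ _
    nlinarith
  have hlip : ∀ δ ∈ Metric.closedBall (0 : A → ℝ) ρ, ∀ δ' ∈ Metric.closedBall (0 : A → ℝ) ρ,
      dist (Φ δ) (Φ δ') ≤ 1 / 2 * dist δ δ' := by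
    intro δ hδ δ' hδ'
    rw [mem_closedBall_zero_iff] at hδ hδ'
    obtain ⟨h1, -⟩ := hMq δ hδ
    obtain ⟨h2, h2'⟩ := hMq δ' hδ'
    have hd : 0 ≤ dist δ δ' := dist_nonneg
    rw [dist_pi_le_iff (by positivity)]
    intro e
    rw [hΦrem, hΦrem, Real.dist_eq]
    have hv : ∀ e : A, |(invRem S (M δ) e.1.1 e.1.2 - (b e.1.1 e.1.2 - S e.1.1 e.1.2)) -
        (invRem S (M δ') e.1.1 e.1.2 - (b e.1.1 e.1.2 - S e.1.1 e.1.2))| ≤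
        120 / 49 * linfNorm S ^ 2 * q * dist δ δ' := by
      intro e
      rw [sub_sub_sub_cancel_right]
      exact abs_invRem_sub_le hSu hSt h1 h2 h2' hq hd (abs_ofSupp_sub_le δ δ') _ _
    rw [← Pi.sub_apply, ← mulVec_sub]
    refine (abs_sum_mul_le (hessSSInv S) _ hv (by positivity) e).trans ?_
    change KH S * _ ≤ _
    nlinarith
  have hcontr : ContractingWith (1 / 2) (hmaps.restrict Φ _ _) := by
    refine ⟨by norm_num, LipschitzWith.of_dist_le_mul fun x y => ?_⟩
    have := hlip x x.2 y y.2
    simpa [Subtype.dist_eq] using this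
  obtain ⟨δ, hδ, hfix, -⟩ := hcontr.exists_fixedPoint' (x := 0)
    Metric.isClosed_closedBall.isComplete hmaps (Metric.mem_closedBall_self hρ) (edist_ne_top _ _)
  -- A fixed point is a solution of the equation, and conversely.
  have hsol : ∀ e : A, (S⁻¹ + M δ)⁻¹ e.1.1 e.1.2 = b e.1.1 e.1.2 := by
    have h1 : δ + hessSSInv S *ᵥ
      (fun e => (S⁻¹ + M δ)⁻¹ e.1.1 e.1.2 - b e.1.1 e.1.2) = δ := hfix
    have h2 := hessSSInv_mulVec_eq_zero hS (add_eq_left.1 h1)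
    intro e
    have := congrFun h2 e
    exact sub_eq_zero.1 this
  -- The transpose of a solution is a solution, so that uniqueness gives symmetry.
  have hsymm : (M δ)ᵀ = M δ := by
    set δ' : A → ℝ := fun e => (M δ)ᵀ e.1.1 e.1.2 with hδ'
    have hMδ' : M δ' = (M δ)ᵀ := ofSupp_restrict fun i j h =>
      ofSupp_apply_of_eq_zero δ (by rwa [← transpose_apply S⁻¹, hTt])
    have hδ'ρ : δ' ∈ Metric.closedBall (0 : A → ℝ) ρ := by
      rw [mem_closedBall_zero_iff] at hδ ⊢
      rw [pi_norm_le_iff_of_nonneg hρ]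
      exact fun e => (abs_ofSupp_le δ _ _).trans hδ
    have hfix' : Φ δ' = δ' := by
      have : (fun e : A => (S⁻¹ + M δ')⁻¹ e.1.1 e.1.2 - b e.1.1 e.1.2) = 0 := by
        ext e
        have h1 : (S⁻¹ + M δ')⁻¹ = ((S⁻¹ + M δ)⁻¹)ᵀ := by
          rw [hMδ', transpose_nonsing_inv, transpose_add, hTt]
        have h2 : supp S⁻¹ (e.1.2, e.1.1) := by
          have := e.2
          rw [supp, ← transpose_apply S⁻¹, hTt] at this
          exact this
        have h3 := hsol ⟨_, h2⟩
        simp only at h3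
        rw [h1, transpose_apply, h3, ← transpose_apply b, hb]
        simp
      simp only [hΦ]
      rw [this, mulVec_zero, add_zero]
    have h1 := hlip δ hδ δ' hδ'ρ
    rw [hfix', show Φ δ = δ from hfix] at h1
    have h2 : dist δ δ' = 0 := le_antisymm (by linarith) dist_nonneg
    rw [← hMδ', ← dist_eq_zero.1 h2]
  refine ⟨M δ, hsymm, fun i j h => ofSupp_apply_of_eq_zero δ h, fun i j =>
    (abs_ofSupp_le δ i j).trans (mem_closedBall_zero_iff.1 hδ), fun i j h => hsol ⟨(i, j), h⟩⟩

end FixedPoint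

/-! ### The primal-dual witness -/

section Witness

variable {p : ℕ}

open Classical in
/-- The irrepresentable condition controls `S Δ S` off the support of `S⁻¹` by its entries on the
support. -/
lemma abs_mul_mul_le_irrep {S Δ : Matrix (Fin p) (Fin p) ℝ} (hS : S.PosDef)
    (hΔ : ∀ i j, S⁻¹ i j = 0 → Δ i j = 0) {c : ℝ} (hc0 : 0 ≤ c)
    (hc : ∀ i j, S⁻¹ i j ≠ 0 → |(S * Δ * S) i j| ≤ c) {i j : Fin p} (hij : S⁻¹ i j = 0) :
    |(S * Δ * S) i j| ≤ irrep S * c := by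
  set δ : {e // supp S⁻¹ e} → ℝ := fun e => Δ e.1.1 e.1.2 with hδ
  have hM : ofSupp S⁻¹ δ = Δ := ofSupp_restrict hΔ
  have h1 := hessSSInv_mulVec hS δ
  rw [hM] at h1
  have h2 := sum_hess_mul (T := S⁻¹) (transpose_eq_of_posDef hS) δ (i, j)
  rw [hM] at h2
  simp only at h2
  have hns : ¬ supp S⁻¹ (i, j) := fun h => h hij
  have h3 : (S * Δ * S) i j = ∑ e', ((hess S).toBlock (fun e => ¬ supp S⁻¹ e) (supp S⁻¹) *
      hessSSInv S) ⟨(i, j), hns⟩ e' * (S * Δ * S) e'.1.1 e'.1.2 := by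
    rw [← h2]
    have : (((hess S).toBlock (fun e => ¬ supp S⁻¹ e) (supp S⁻¹) *
      hessSSInv S) *ᵥ fun e' => (S * Δ * S) e'.1.1 e'.1.2) ⟨(i, j), hns⟩ =
        ((hess S).toBlock (fun e => ¬ supp S⁻¹ e) (supp S⁻¹) *ᵥ δ) ⟨(i, j), hns⟩ := by
      rw [← mulVec_mulVec, h1]
    exact this.symm
  rw [h3]
  exact abs_sum_mul_le _ _ (fun e => hc _ _ e.2) hc0 _

open Classical in
lemma one_le_sq_mul_KH {S : Matrix (Fin p) (Fin p) ℝ} (hS : S.PosDef) (i : Fin p) :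
    1 ≤ linfNorm S ^ 2 * KH S := by
  have hi : supp S⁻¹ (i, i) := hS.inv.diag_pos.ne'
  set B := (hess S).toBlock (supp S⁻¹) (supp S⁻¹) with hB
  have h1 : B * hessSSInv S = 1 := mul_nonsing_inv _ (posDef_hess_block hS).det_pos.ne'.isUnit
  have h2 : 1 ≤ linfNorm (B * hessSSInv S) := by
    rw [h1]
    refine le_trans ?_ (sum_abs_le_linfNorm _ ⟨(i, i), hi⟩)
    refine le_trans (by simp) (Finset.single_le_sum (fun e _ => abs_nonneg _)
      (Finset.mem_univ (⟨(i, i), hi⟩ : {e // supp S⁻¹ e})))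
  have h3 : linfNorm B ≤ linfNorm S ^ 2 := by
    refine linfNorm_le (sq_nonneg _) fun e => ?_
    calc ∑ e', |B e e'| ≤ ∑ e' : Fin p × Fin p, |hess S e.1 e'| := by
          change ∑ e' : {e // supp S⁻¹ e}, |hess S e.1 e'.1| ≤ _
          rw [← Finset.sum_subtype (p := supp S⁻¹) (Finset.univ.filter (supp S⁻¹)) (by simp)
            (fun e' => |hess S e.1 e'|)]
          exact Finset.sum_le_sum_of_subset_of_nonneg (Finset.filter_subset _ _)
            fun _ _ _ => abs_nonneg _
      _ = (∑ k, |S e.1.1 k|) * ∑ l, |S e.1.2 l| := by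
          rw [Fintype.sum_prod_type, Finset.sum_mul_sum]
          refine Finset.sum_congr rfl fun k _ => Finset.sum_congr rfl fun l _ => ?_
          rw [hess, kroneckerMap_apply, abs_mul]
      _ ≤ linfNorm S ^ 2 := by
          rw [sq]
          exact mul_le_mul (sum_abs_le_linfNorm S _) (sum_abs_le_linfNorm S _)
            (Finset.sum_nonneg fun _ _ => abs_nonneg _) (linfNorm_nonneg S)
  exact h2.trans ((linfNorm_mul_le _ _).trans
    (mul_le_mul_of_nonneg_right h3 (linfNorm_nonneg _)))

lemma eq_one_of_maxDegree_eq_zero {S : Matrix (Fin p) (Fin p) ℝ} (hS : S.PosDef)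
    (hdiag : ∀ j, S j j = 1) (hd : maxDegree S⁻¹ = 0) : S = 1 := by
  have h0 : ∀ i j, i ≠ j → S⁻¹ i j = 0 := by
    intro i j hij
    by_contra h
    have h1 : (Finset.univ.filter fun i => i ≠ j ∧ S⁻¹ i j ≠ 0).card ≤ maxDegree S⁻¹ :=
      Finset.le_sup (f := fun j => (Finset.univ.filter fun i => i ≠ j ∧ S⁻¹ i j ≠ 0).card)
        (Finset.mem_univ j)
    rw [hd, Nat.le_zero, Finset.card_eq_zero] at h1
    have : i ∈ (Finset.univ.filter fun i => i ≠ j ∧ S⁻¹ i j ≠ 0) := by simp [hij, h]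
    rw [h1] at this
    simp at this
  ext i j
  by_cases hij : i = j
  · subst hij; rw [hdiag, one_apply_eq]
  · rw [one_apply_ne hij]
    have h1 : (S⁻¹ * S) i j = 0 := by
      rw [nonsing_inv_mul _ hS.det_pos.ne'.isUnit, one_apply_ne hij]
    rw [mul_apply, Finset.sum_eq_single i (fun k _ hk => by rw [h0 i k hk.symm, zero_mul])
      (by simp)] at h1
    exact (mul_eq_zero.1 h1).resolve_left hS.inv.diag_pos.ne'

open Classical in
lemma card_support_row_le {S : Matrix (Fin p) (Fin p) ℝ} (hS : S.PosDef) (i : Fin p) :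
    ((Finset.univ.filter fun j => S⁻¹ i j ≠ 0).card : ℝ) ≤ maxDegree S⁻¹ + 1 := by
  have hTt : S⁻¹ᵀ = S⁻¹ := transpose_eq_of_posDef hS.inv
  have h1 : (Finset.univ.filter fun j => j ≠ i ∧ S⁻¹ j i ≠ 0).card ≤ maxDegree S⁻¹ := by
    exact Finset.le_sup (f := fun j => (Finset.univ.filter fun i => i ≠ j ∧ S⁻¹ i j ≠ 0).card)
      (Finset.mem_univ i)
  have h2 : (Finset.univ.filter fun j => S⁻¹ i j ≠ 0) ⊆
      insert i (Finset.univ.filter fun j => j ≠ i ∧ S⁻¹ j i ≠ 0) := by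
    intro j hj
    simp only [Finset.mem_filter, Finset.mem_univ, true_and, Finset.mem_insert] at hj ⊢
    by_cases hji : j = i
    · exact Or.inl hji
    · refine Or.inr ⟨hji, ?_⟩
      rwa [← transpose_apply S⁻¹, hTt]
  have h3 := (Finset.card_le_card h2).trans (Finset.card_insert_le _ _)
  exact_mod_cast h3.trans (Nat.add_le_add_right h1 1)

/-- Consequences of the bound on `lam` for the radius `(3 / 2) h lam`, where `d + 1 ≤ 2 d` and
`1 ≤ K ^ 2 * h` absorb the diagonal. -/
lemma radius_bounds {K h d κ lam : ℝ} (hK0 : 0 ≤ K) (hh : 0 ≤ h) (hKh : 1 ≤ K ^ 2 * h)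
    (hd1 : 1 ≤ d) (hκ : 0 < κ) (hlam : 0 < lam)
    (hcond : 6 * (1 + κ / 4) * K * h * max 1 ((1 + 4 / κ) * K ^ 2 * h) * d * lam < 1) :
    K * ((d + 1) * (3 / 2 * h * lam)) ≤ κ / 8 ∧
      h * K ^ 2 * (K * ((d + 1) * (3 / 2 * h * lam))) ≤ κ / 8 := by
  set y := K ^ 3 * h ^ 2 * lam with hy
  have hy0 : 0 ≤ y := by positivity
  have hyD : y * (d + 1) ≤ κ / 12 := by
    have h1 : 6 * (1 + κ / 4) * K * h * ((1 + 4 / κ) * K ^ 2 * h) * d * lam ≤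
        6 * (1 + κ / 4) * K * h * max 1 ((1 + 4 / κ) * K ^ 2 * h) * d * lam := by
      gcongr
      exact le_max_right _ _
    have h2 : κ * (6 * (1 + κ / 4) * K * h * ((1 + 4 / κ) * K ^ 2 * h) * d * lam) =
        6 * (1 + κ / 4) * (κ + 4) * (y * d) := by
      rw [hy]; field_simp
    have h3 : 6 * (1 + κ / 4) * (κ + 4) * (y * d) ≤ κ := by
      rw [← h2]
      exact mul_le_of_le_one_right hκ.le (h1.trans hcond.le)
    have h4 : 0 ≤ y * d := by positivity
    have h5 : 24 * (y * d) ≤ 6 * (1 + κ / 4) * (κ + 4) * (y * d) :=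
      mul_le_mul_of_nonneg_right (by nlinarith) h4
    have h6 : y * 1 ≤ y * d := mul_le_mul_of_nonneg_left hd1 hy0
    linarith
  have hq2 : h * K ^ 2 * (K * ((d + 1) * (3 / 2 * h * lam))) ≤ κ / 8 := by
    have : h * K ^ 2 * (K * ((d + 1) * (3 / 2 * h * lam))) = 3 / 2 * (y * (d + 1)) := by
      rw [hy]; ring
    rw [this]; linarith
  refine ⟨le_trans ?_ hq2, hq2⟩
  rw [mul_comm h]
  exact le_mul_of_one_le_left (by positivity) hKh

open Classical in
/-- The primal-dual witness argument: if the input matrix `R` of the graphical lasso is within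
`κ lam / 4` of `S`, its minimizer is unique, supported on the graph of `S⁻¹`, and close to `S⁻¹`.
The radius of localization used is `(3 / 2) K_H lam`, smaller than what is claimed; the slack pays
for the diagonal, which `maxDegree` does not count. -/
theorem glasso_of_close {S R : Matrix (Fin p) (Fin p) ℝ} (hS : S.PosDef) (hdiag : ∀ j, S j j = 1)
    {κ lam : ℝ} (hκ : 0 < κ) (hκ1 : κ < 1) (hirr : irrep S < 1 - κ) (hlam : 0 < lam)
    (hcond : 6 * (1 + κ / 4) * linfNorm S * KH S *
      max 1 ((1 + 4 / κ) * linfNorm S ^ 2 * KH S) * (maxDegree S⁻¹ : ℝ) * lam < 1)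
    (hR : Rᵀ = R) (hRdiag : ∀ i, R i i = 1) (hRS : ∀ i j, |R i j - S i j| ≤ κ / 4 * lam) :
    ∃ Θ : Matrix (Fin p) (Fin p) ℝ,
      (IsGlassoMin R lam Θ ∧ ∀ Θ', IsGlassoMin R lam Θ' → Θ' = Θ) ∧
      (∀ i j, S⁻¹ i j = 0 → Θ i j = 0) ∧
      ∀ i j, |Θ i j - S⁻¹ i j| ≤ 2 * KH S * (1 + κ / 4) * lam := by
  have hSt := transpose_eq_of_posDef hS
  have hSu : IsUnit S.det := hS.det_pos.ne'.isUnit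
  have hKH := KH_nonneg S
  have hRSlam : ∀ i j, |R i j - S i j| ≤ lam := fun i j => (hRS i j).trans (by nlinarith)
  have hfinal : 0 ≤ 2 * KH S * (1 + κ / 4) * lam := by positivity
  rcases Nat.eq_zero_or_pos (maxDegree S⁻¹) with hd | hd
  · -- Without edges `S = 1`, and the identity is itself optimal, for every `lam`.
    have h1 := eq_one_of_maxDegree_eq_zero hS hdiag hd
    subst h1
    refine ⟨1, isGlassoMin_of_kkt hS (fun i => ?_) (fun i j => ?_) (fun i j hij => ?_),
      fun i j h => by simpa using h, fun i j => by simpa using hfinal⟩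
    · rw [inv_one, Matrix.sub_apply, hRdiag, one_apply_eq, sub_self]
    · rw [inv_one, Matrix.sub_apply]; exact hRSlam i j
    · rw [one_apply_ne hij]; simp
  set K := linfNorm S with hK
  set h := KH S with hh
  set d : ℝ := (maxDegree S⁻¹ : ℝ) with hddef
  have hd1 : 1 ≤ d := by rw [hddef]; exact_mod_cast hd
  obtain ⟨i₀⟩ : Nonempty (Fin p) := by
    rw [← not_isEmpty_iff]
    intro hemp
    simp [maxDegree, Finset.univ_eq_empty] at hd
  have hK0 : 0 ≤ K := linfNorm_nonneg S
  have hKh : 1 ≤ K ^ 2 * h := one_le_sq_mul_KH hS i₀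
  set ρ := 3 / 2 * h * lam with hρ
  have hρ0 : 0 ≤ ρ := by positivity
  set q := K * ((d + 1) * ρ) with hq
  have hq0 : 0 ≤ q := by positivity
  obtain ⟨hq1, hq2⟩ : q ≤ κ / 8 ∧ h * K ^ 2 * q ≤ κ / 8 :=
    radius_bounds hK0 hKH hKh hd1 hκ hlam hcond
  -- The restricted problem, and its stationarity conditions.
  have hclosed : IsClosed {Θ : Matrix (Fin p) (Fin p) ℝ | ∀ i j, S⁻¹ i j = 0 → Θ i j = 0} := by
    have : {Θ : Matrix (Fin p) (Fin p) ℝ | ∀ i j, S⁻¹ i j = 0 → Θ i j = 0} =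
        ⋂ i, ⋂ j, ⋂ _ : S⁻¹ i j = 0, {Θ | Θ i j = 0} := by
      ext Θ; simp
    rw [this]
    exact isClosed_iInter fun i => isClosed_iInter fun j => isClosed_iInter fun _ =>
      isClosed_eq (continuous_id.matrix_elem i j) continuous_const
  obtain ⟨Θ, hΘS, hΘ, hmin⟩ := exists_min_on_closed (R := R) (lam := lam) hS
    (fun i => by rw [Matrix.sub_apply, hRdiag, hdiag, sub_self]) (fun i j => hRSlam i j) hclosed
    hS.inv (fun i j hij => hij)
  obtain ⟨hG0, hG1⟩ := kkt_of_restricted_min hlam.le hR (transpose_eq_of_posDef hS.inv) hΘ hΘS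
    hmin
  have hGb : ∀ i j, S⁻¹ i j ≠ 0 → |(R - Θ⁻¹) i j| ≤ lam := by
    intro i j hij
    by_cases e : i = j
    · subst e; rw [hG0 i hij, abs_zero]; exact hlam.le
    · exact (hG1 i j e hij).1
  -- Localization of the restricted minimizer.
  obtain ⟨Δ, hΔt, hΔS, hΔρ, hΔb⟩ := exists_inv_eq_on_support (b := Θ⁻¹) (w := (1 + κ / 4) * lam)
    hS (transpose_eq_of_posDef hΘ.inv) hρ0 (by positivity) (by positivity)
    (card_support_row_le hS) (by linarith) (by linarith)
    (by rw [hρ]; nlinarith [mul_nonneg hKH hlam.le]) (fun i j hij => by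
      have e : Θ⁻¹ i j - S i j = (R i j - S i j) - (R - Θ⁻¹) i j := by
        rw [Matrix.sub_apply]; ring
      rw [e]
      refine (abs_sub _ _).trans ?_
      linarith [hRS i j, hGb i j hij])
  have hSΔ : linfNorm (S * Δ) ≤ q := (linfNorm_mul_le _ _).trans
    (mul_le_mul_of_nonneg_left (linfNorm_le_of_support hρ0 (by positivity)
      (card_support_row_le hS) hΔS hΔρ) hK0)
  have hpd : (S⁻¹ + Δ).PosDef := posDef_inv_add hS hΔt (by linarith)
  have hΘeq : Θ = S⁻¹ + Δ := by
    refine eq_of_inv_eq_on hΘ hpd fun i j => ?_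
    by_cases hij : S⁻¹ i j = 0
    · have hji : S⁻¹ j i = 0 := by
        rwa [← transpose_apply S⁻¹, transpose_eq_of_posDef hS.inv]
      exact Or.inr ⟨hΘS j i hji, by rw [Matrix.add_apply, hji, hΔS j i hji, add_zero]⟩
    · exact Or.inl (hΔb i j hij).symm
  have hrem : ∀ i j, |invRem S Δ i j| ≤ κ / 4 * lam := by
    intro i j
    refine (abs_invRem_le hSu hSt hSΔ (by rwa [hΔt]) (by linarith) hρ0 hΔρ i j).trans ?_
    have : 8 / 7 * linfNorm S ^ 2 * q * ρ = 12 / 7 * lam * (h * K ^ 2 * q) := by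
      rw [hρ, ← hK]; ring
    rw [this]
    nlinarith
  have hdecomp : ∀ i j, (S * Δ * S) i j =
      invRem S Δ i j - (R i j - S i j) + (R - Θ⁻¹) i j := by
    intro i j
    simp only [invRem, hΘeq, Matrix.add_apply, Matrix.sub_apply]
    ring
  -- Dual feasibility off the support.
  have hoff : ∀ i j, S⁻¹ i j = 0 → |(R - Θ⁻¹) i j| ≤ lam := by
    intro i j hij
    have h1 : |(S * Δ * S) i j| ≤ irrep S * ((1 + κ / 2) * lam) := by
      refine abs_mul_mul_le_irrep hS hΔS (by positivity) (fun i j hij => ?_) hij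
      rw [hdecomp]
      refine (abs_add_le _ _).trans ?_
      have := abs_sub (invRem S Δ i j) (R i j - S i j)
      linarith [hrem i j, hRS i j, hGb i j hij]
    have h2 : irrep S * ((1 + κ / 2) * lam) ≤ (1 - κ) * ((1 + κ / 2) * lam) :=
      mul_le_mul_of_nonneg_right hirr.le (by positivity)
    have h3 : (R - Θ⁻¹) i j = (S * Δ * S) i j - (invRem S Δ i j - (R i j - S i j)) := by
      rw [hdecomp]; ring
    rw [h3]
    refine (abs_sub _ _).trans ?_
    have := abs_sub (invRem S Δ i j) (R i j - S i j)
    nlinarith [hrem i j, hRS i j, mul_nonneg (sq_nonneg κ) hlam.le]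
  refine ⟨Θ, isGlassoMin_of_kkt hΘ (fun i => hG0 i hS.inv.diag_pos.ne') (fun i j => ?_)
    (fun i j hij => ?_), hΘS, fun i j => ?_⟩
  · by_cases hij : S⁻¹ i j = 0
    · exact hoff i j hij
    · exact hGb i j hij
  · by_cases hij' : S⁻¹ i j = 0
    · rw [hΘS i j hij', abs_zero, mul_zero, mul_zero, neg_zero]
    · exact (hG1 i j hij hij').2
  · rw [hΘeq, Matrix.add_apply, add_sub_cancel_left]
    refine (hΔρ i j).trans ?_
    have h1 : 0 ≤ h * lam := mul_nonneg hKH hlam.le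
    have h2 : 0 ≤ h * lam * κ := mul_nonneg h1 hκ.le
    have h3 : 2 * h * (1 + κ / 4) * lam = ρ + (1 / 2 * (h * lam) + 1 / 2 * (h * lam * κ)) := by
      rw [hρ]; ring
    rw [h3]
    linarith

end Witness

end RankGlasso

namespace RankGlasso

/-! ### Sign correlations in the Gaussian plane -/

section SignCorrelation

lemma measurable_realSign : Measurable Real.sign := by
  unfold Real.sign
  exact Measurable.ite measurableSet_Iio measurable_const
    (Measurable.ite measurableSet_Ioi measurable_const measurable_const)

lemma abs_realSign_le (x : ℝ) : |Real.sign x| ≤ 1 := by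
  rcases Real.sign_apply_eq x with h | h | h <;> simp [h]

lemma realSign_mul_of_pos {r : ℝ} (hr : 0 < r) (x : ℝ) : Real.sign (r * x) = Real.sign x := by
  rcases lt_trichotomy x 0 with h | h | h
  · rw [Real.sign_of_neg h, Real.sign_of_neg (mul_neg_of_pos_of_neg hr h)]
  · simp [h]
  · rw [Real.sign_of_pos h, Real.sign_of_pos (mul_pos hr h)]

lemma realSign_neg (x : ℝ) : Real.sign (-x) = -Real.sign x := by
  rcases lt_trichotomy x 0 with h | h | h
  · rw [Real.sign_of_neg h, Real.sign_of_pos (neg_pos.2 h)]; norm_num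
  · simp [h]
  · rw [Real.sign_of_pos h, Real.sign_of_neg (neg_lt_zero.2 h)]

/-- Integration of a function of the direction only against the standard Gaussian measure of the
plane, in polar coordinates, up to the radial factor. -/
lemma integral_gaussian_prod_aux {f : ℝ × ℝ → ℝ}
    (hf : ∀ r > 0, ∀ x y : ℝ, f (r * x, r * y) = f (x, y)) :
    ∫ z, f z ∂((gaussianReal 0 1).prod (gaussianReal 0 1)) =
      (∫ r in Set.Ioi (0 : ℝ), r * ((2 * Real.pi)⁻¹ * Real.exp (-(r ^ 2) / 2))) *
        ∫ t in Set.Ioo (-Real.pi) Real.pi, f (Real.cos t, Real.sin t) := by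
  have h1 : (gaussianReal 0 1).prod (gaussianReal 0 1) =
      (volume : Measure (ℝ × ℝ)).withDensity
        (fun z => gaussianPDF 0 1 z.1 * gaussianPDF 0 1 z.2) := by
    rw [gaussianReal_of_var_ne_zero 0 one_ne_zero,
      prod_withDensity (measurable_gaussianPDF 0 1) (measurable_gaussianPDF 0 1)]
    rfl
  rw [h1, integral_withDensity_eq_integral_toReal_smul]
  rotate_left
  · have := measurable_gaussianPDF 0 1
    fun_prop
  · exact Filter.Eventually.of_forall fun z => ENNReal.mul_lt_top gaussianPDF_lt_top
      gaussianPDF_lt_top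
  rw [← integral_comp_polarCoord_symm, polarCoord_target, Measure.volume_eq_prod,
    ← setIntegral_prod_mul]
  refine setIntegral_congr_fun (measurableSet_Ioi.prod measurableSet_Ioo) fun z hz => ?_
  have hr : 0 < z.1 := hz.1
  simp only [polarCoord_symm_apply, hf z.1 hr, smul_eq_mul, ENNReal.toReal_mul, toReal_gaussianPDF,
    gaussianPDFReal, sub_zero, NNReal.coe_one, mul_one]
  have h2 : (√(2 * Real.pi))⁻¹ * Real.exp (-(z.1 * Real.cos z.2) ^ 2 / 2) *
      ((√(2 * Real.pi))⁻¹ * Real.exp (-(z.1 * Real.sin z.2) ^ 2 / 2)) =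
      (2 * Real.pi)⁻¹ * Real.exp (-(z.1 ^ 2) / 2) := by
    have e1 : (√(2 * Real.pi))⁻¹ * (√(2 * Real.pi))⁻¹ = (2 * Real.pi)⁻¹ := by
      rw [← mul_inv, Real.mul_self_sqrt (by positivity)]
    have e2 : Real.exp (-(z.1 * Real.cos z.2) ^ 2 / 2) *
        Real.exp (-(z.1 * Real.sin z.2) ^ 2 / 2) = Real.exp (-(z.1 ^ 2) / 2) := by
      rw [← Real.exp_add]
      congr 1
      linear_combination (-(z.1 ^ 2) / 2) * Real.sin_sq_add_cos_sq z.2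
    rw [← e1, ← e2]; ring
  rw [h2]; ring

lemma integral_gaussian_prod {f : ℝ × ℝ → ℝ}
    (hf : ∀ r > 0, ∀ x y : ℝ, f (r * x, r * y) = f (x, y)) :
    ∫ z, f z ∂((gaussianReal 0 1).prod (gaussianReal 0 1)) =
      (2 * Real.pi)⁻¹ * ∫ t in Set.Ioo (-Real.pi) Real.pi, f (Real.cos t, Real.sin t) := by
  -- The radial factor follows from the case `f = 1`.
  have h1 := integral_gaussian_prod_aux (f := fun _ => 1) (fun _ _ _ _ => rfl)
  have hpi := Real.pi_pos
  simp only [integral_const, measureReal_def, MeasurableSet.univ, Measure.restrict_apply,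
    Set.univ_inter, Real.volume_Ioo, measure_univ, ENNReal.toReal_one, smul_eq_mul, mul_one] at h1
  rw [ENNReal.toReal_ofReal (by linarith)] at h1
  rw [integral_gaussian_prod_aux hf]
  congr 1
  refine eq_inv_of_mul_eq_one_left ?_
  rw [h1]; ring

lemma integral_sign_cos_mul_sign_sin {φ : ℝ} (h1 : -(Real.pi / 2) ≤ φ) (h2 : φ ≤ Real.pi / 2) :
    ∫ t in Set.Ioo (-Real.pi) Real.pi,
      Real.sign (Real.cos t) * Real.sign (Real.sin φ * Real.cos t + Real.cos φ * Real.sin t) =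
      4 * φ := by
  set g : ℝ → ℝ := fun t =>
    Real.sign (Real.cos t) * Real.sign (Real.sin φ * Real.cos t + Real.cos φ * Real.sin t) with hg
  have hpi := Real.pi_pos
  have hper : Function.Periodic g Real.pi := by
    intro t
    simp only [hg, Real.cos_add_pi, Real.sin_add_pi, realSign_neg]
    rw [show Real.sin φ * -Real.cos t + Real.cos φ * -Real.sin t =
      -(Real.sin φ * Real.cos t + Real.cos φ * Real.sin t) by ring, realSign_neg]
    ring
  have hmeas : Measurable g := by
    have := measurable_realSign
    fun_prop
  have hint : ∀ a b : ℝ, IntervalIntegrable g volume a b := by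
    intro a b
    refine (intervalIntegrable_const (c := (1 : ℝ))).mono_fun hmeas.aestronglyMeasurable ?_
    refine Filter.Eventually.of_forall fun t => ?_
    simp only [hg, norm_mul, Real.norm_eq_abs, abs_one]
    exact mul_le_one₀ (abs_realSign_le _) (abs_nonneg _) (abs_realSign_le _)
  have hA : ∫ t in (-(Real.pi / 2))..(-φ), g t = -(Real.pi / 2 - φ) := by
    have : ∫ t in (-(Real.pi / 2))..(-φ), g t = ∫ t in (-(Real.pi / 2))..(-φ), (-1 : ℝ) := by
      rw [intervalIntegral.integral_of_le (by linarith),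
        intervalIntegral.integral_of_le (by linarith), integral_Ioc_eq_integral_Ioo,
        integral_Ioc_eq_integral_Ioo]
      refine setIntegral_congr_fun measurableSet_Ioo fun t ht => ?_
      simp only [hg]
      rw [← Real.sin_add, Real.sign_of_pos (Real.cos_pos_of_mem_Ioo ⟨ht.1, by linarith [ht.2]⟩),
        Real.sign_of_neg (Real.sin_neg_of_neg_of_neg_pi_lt (by linarith [ht.2])
          (by linarith [ht.1]))]
      norm_num
    rw [this, intervalIntegral.integral_const, smul_eq_mul]; ring
  have hB : ∫ t in (-φ)..(Real.pi / 2), g t = Real.pi / 2 + φ := by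
    have : ∫ t in (-φ)..(Real.pi / 2), g t = ∫ t in (-φ)..(Real.pi / 2), (1 : ℝ) := by
      rw [intervalIntegral.integral_of_le (by linarith),
        intervalIntegral.integral_of_le (by linarith), integral_Ioc_eq_integral_Ioo,
        integral_Ioc_eq_integral_Ioo]
      refine setIntegral_congr_fun measurableSet_Ioo fun t ht => ?_
      simp only [hg]
      rw [← Real.sin_add, Real.sign_of_pos (Real.cos_pos_of_mem_Ioo ⟨by linarith [ht.1], ht.2⟩),
        Real.sign_of_pos (Real.sin_pos_of_pos_of_lt_pi (by linarith [ht.1])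
          (by linarith [ht.2]))]
      norm_num
    rw [this, intervalIntegral.integral_const, smul_eq_mul]; ring
  have hC : ∫ t in (-(Real.pi / 2))..(-(Real.pi / 2) + Real.pi), g t = 2 * φ := by
    rw [show -(Real.pi / 2) + Real.pi = Real.pi / 2 by ring,
      ← intervalIntegral.integral_add_adjacent_intervals (hint _ (-φ)) (hint _ _), hA, hB]
    ring
  rw [← integral_Ioc_eq_integral_Ioo, ← intervalIntegral.integral_of_le (by linarith),
    ← intervalIntegral.integral_add_adjacent_intervals (hint _ 0) (hint _ _)]
  have e1 := hper.intervalIntegral_add_eq (-Real.pi) (-(Real.pi / 2))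
  have e2 := hper.intervalIntegral_add_eq 0 (-(Real.pi / 2))
  rw [neg_add_cancel, hC] at e1
  rw [zero_add, hC] at e2
  rw [e1, e2]; ring

/-- Sheppard's formula for independent standard Gaussian coordinates. -/
lemma integral_sign_mul_sign {φ : ℝ} (h1 : -(Real.pi / 2) ≤ φ) (h2 : φ ≤ Real.pi / 2) :
    ∫ z : ℝ × ℝ, Real.sign z.1 * Real.sign (Real.sin φ * z.1 + Real.cos φ * z.2)
      ∂((gaussianReal 0 1).prod (gaussianReal 0 1)) = 2 / Real.pi * φ := by
  rw [integral_gaussian_prod (f := fun z => Real.sign z.1 *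
    Real.sign (Real.sin φ * z.1 + Real.cos φ * z.2)), integral_sign_cos_mul_sign_sin h1 h2]
  · field_simp; norm_num
  · intro r hr x y
    simp only
    rw [realSign_mul_of_pos hr, show Real.sin φ * (r * x) + Real.cos φ * (r * y) =
      r * (Real.sin φ * x + Real.cos φ * y) by ring, realSign_mul_of_pos hr]

end SignCorrelation

/-! ### Signs of differences of independent Gaussian vectors -/

section Gaussian

variable {Ω : Type*} [MeasurableSpace Ω] {μ : Measure Ω}

/-- **Sheppard's formula** for the sign correlation of a centred Gaussian pair with common variance
`v` and correlation `sin φ`. -/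
lemma integral_sign_mul_sign_of_gaussian [IsProbabilityMeasure μ] {A B : Ω → ℝ}
    (h : HasGaussianLaw (fun ω => (A ω, B ω)) μ)
    (hA : ∫ ω, A ω ∂μ = 0) (hB : ∫ ω, B ω ∂μ = 0) {v φ : ℝ} (hv : 0 < v)
    (h1 : -(Real.pi / 2) < φ) (h2 : φ < Real.pi / 2) (hAA : cov[A, A; μ] = v)
    (hBB : cov[B, B; μ] = v) (hAB : cov[A, B; μ] = v * Real.sin φ) :
    ∫ ω, Real.sign (A ω) * Real.sign (B ω) ∂μ = 2 / Real.pi * φ := by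
  have hc : 0 < Real.cos φ := Real.cos_pos_of_mem_Ioo ⟨h1, h2⟩
  have hs : 0 < √v := Real.sqrt_pos.2 hv
  have hs2 : √v * √v = v := Real.mul_self_sqrt hv.le
  have hsc := Real.sin_sq_add_cos_sq φ
  have hA2 : MemLp A 2 μ := h.fst.memLp_two
  have hB2 : MemLp B 2 μ := h.snd.memLp_two
  -- Gram-Schmidt: `A = √v G₁` and `B = √v (sin φ G₁ + cos φ G₂)` with `G₁`, `G₂` independent.
  set G₁ : Ω → ℝ := fun ω => (√v)⁻¹ * A ω with hG₁
  set G₂ : Ω → ℝ := fun ω => (√v * Real.cos φ)⁻¹ * (B ω - Real.sin φ * A ω) with hG₂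
  have hG : HasGaussianLaw (fun ω => (G₁ ω, G₂ ω)) μ := by
    let L : ℝ × ℝ →L[ℝ] ℝ × ℝ :=
      ((√v)⁻¹ • ContinuousLinearMap.fst ℝ ℝ ℝ).prod
        ((√v * Real.cos φ)⁻¹ • (ContinuousLinearMap.snd ℝ ℝ ℝ -
          Real.sin φ • ContinuousLinearMap.fst ℝ ℝ ℝ))
    exact h.map_fun L
  have hsA : MemLp (fun ω => Real.sin φ * A ω) 2 μ := hA2.const_mul _
  have hcov : cov[G₁, G₂; μ] = 0 := by
    rw [hG₁, hG₂, covariance_const_mul_left, covariance_const_mul_right,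
      covariance_fun_sub_right hA2 hB2 hsA, covariance_const_mul_right, hAB, hAA]
    ring
  have hind : IndepFun G₁ G₂ μ := hG.indepFun_of_covariance_eq_zero hcov
  have hvar1 : Var[G₁; μ] = 1 := by
    rw [← covariance_self hG.fst.aemeasurable, hG₁, covariance_const_mul_left,
      covariance_const_mul_right, hAA]
    field_simp
    nlinarith
  have hvar2 : Var[G₂; μ] = 1 := by
    rw [← covariance_self hG.snd.aemeasurable, hG₂, covariance_const_mul_left,
      covariance_const_mul_right, covariance_fun_sub_fun_sub hB2 hsA hB2 hsA,
      covariance_const_mul_right, covariance_const_mul_left, covariance_const_mul_left,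
      covariance_const_mul_right, covariance_comm B A, hAA, hBB, hAB]
    field_simp
    rw [Real.sq_sqrt hv.le]
    linear_combination -v * hsc
  have hmean1 : ∫ ω, G₁ ω ∂μ = 0 := by
    rw [hG₁, integral_const_mul, hA, mul_zero]
  have hmean2 : ∫ ω, G₂ ω ∂μ = 0 := by
    rw [hG₂, integral_const_mul, integral_sub h.snd.integrable (h.fst.integrable.const_mul _),
      integral_const_mul, hA, hB]
    simp
  have hlaw1 : μ.map G₁ = gaussianReal 0 1 := by
    rw [hG.fst.map_eq_gaussianReal, hmean1, hvar1, Real.toNNReal_one]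
  have hlaw2 : μ.map G₂ = gaussianReal 0 1 := by
    rw [hG.snd.map_eq_gaussianReal, hmean2, hvar2, Real.toNNReal_one]
  have hjoint : μ.map (fun ω => (G₁ ω, G₂ ω)) = (gaussianReal 0 1).prod (gaussianReal 0 1) := by
    rw [(indepFun_iff_map_prod_eq_prod_map_map hG.fst.aemeasurable hG.snd.aemeasurable).1 hind,
      hlaw1, hlaw2]
  have hmeas : Measurable fun z : ℝ × ℝ =>
      Real.sign z.1 * Real.sign (Real.sin φ * z.1 + Real.cos φ * z.2) := by
    have := measurable_realSign
    fun_prop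
  rw [← integral_sign_mul_sign h1.le h2.le, ← hjoint,
    integral_map hG.aemeasurable hmeas.aestronglyMeasurable]
  congr 1
  ext ω
  have e1 : A ω = √v * G₁ ω := by rw [hG₁]; field_simp
  have e2 : B ω = √v * (Real.sin φ * G₁ ω + Real.cos φ * G₂ ω) := by
    rw [hG₁, hG₂]; field_simp; ring
  rw [e1, e2, realSign_mul_of_pos hs, realSign_mul_of_pos hs]

variable {n p : ℕ} {S : Matrix (Fin p) (Fin p) ℝ} {Z : Fin n → Ω → EuclideanSpace ℝ (Fin p)}

lemma covariance_same (hS : S.PosSemidef)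
    (hZ : ∀ k, HasLaw (Z k) (multivariateGaussian 0 S) μ) (k : Fin n) (i j : Fin p) :
    cov[fun ω => Z k ω i, fun ω => Z k ω j; μ] = S i j := by
  rw [← covariance_eval_multivariateGaussian (μ := 0) hS i j, ← (hZ k).map_eq,
    covariance_map_fun (by fun_prop) (by fun_prop) (hZ k).aemeasurable]

lemma integral_coord (hS : S.PosSemidef)
    (hZ : ∀ k, HasLaw (Z k) (multivariateGaussian 0 S) μ) (k : Fin n) (i : Fin p) :
    ∫ ω, Z k ω i ∂μ = 0 := by
  have h1 : ∫ x : EuclideanSpace ℝ (Fin p), x i ∂(multivariateGaussian 0 S) = 0 := by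
    have h2 := measurePreserving_eval_multivariateGaussian (μ := 0) hS (i := i)
    have h3 : ∫ y, y ∂(gaussianReal ((0 : EuclideanSpace ℝ (Fin p)) i) (S i i).toNNReal) = 0 := by
      simp
    rw [← h2.map_eq, integral_map h2.measurable.aemeasurable (by fun_prop)] at h3
    exact h3
  rw [← (hZ k).map_eq, integral_map (hZ k).aemeasurable (by fun_prop)] at h1
  exact h1

lemma memLp_coord (hZ : ∀ k, HasLaw (Z k) (multivariateGaussian 0 S) μ) (k : Fin n) (i : Fin p) :
    MemLp (fun ω => Z k ω i) 2 μ :=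
  (((hZ k).hasGaussianLaw).map_fun (EuclideanSpace.proj i)).memLp_two

lemma covariance_ne (hZ : ∀ k, HasLaw (Z k) (multivariateGaussian 0 S) μ) (hind : iIndepFun Z μ)
    {k l : Fin n} (hkl : k ≠ l) (i j : Fin p) :
    cov[fun ω => Z k ω i, fun ω => Z l ω j; μ] = 0 := by
  refine IndepFun.covariance_eq_zero ?_ (memLp_coord hZ k i) (memLp_coord hZ l j)
  exact (hind.indepFun hkl).comp (φ := fun x : EuclideanSpace ℝ (Fin p) => x i)
    (ψ := fun x : EuclideanSpace ℝ (Fin p) => x j) (by fun_prop) (by fun_prop)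

lemma hasGaussianLaw_diff (hZ : ∀ k, HasLaw (Z k) (multivariateGaussian 0 S) μ)
    (hind : iIndepFun Z μ) (k l m : Fin n) (i j : Fin p) :
    HasGaussianLaw (fun ω => (Z k ω i - Z l ω i, Z k ω j - Z m ω j)) μ := by
  have h1 := iIndepFun.hasGaussianLaw (fun k => (hZ k).hasGaussianLaw) hind
  let e : Fin n → Fin p → ((Fin n → EuclideanSpace ℝ (Fin p)) →L[ℝ] ℝ) := fun k i =>
    (EuclideanSpace.proj i).comp (ContinuousLinearMap.proj k)
  exact h1.map_fun ((e k i - e l i).prod (e k j - e m j))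

/-- The signs of the differences of three independent Gaussian vectors are correlated according to
Sheppard's formula with correlation `S i j / 2`. -/
lemma integral_sign_diff [IsProbabilityMeasure μ] (hS : S.PosSemidef)
    (hdiag : ∀ j, S j j = 1) (i j : Fin p)
    (hZ : ∀ k, HasLaw (Z k) (multivariateGaussian 0 S) μ) (hind : iIndepFun Z μ)
    {k l m : Fin n} (hkl : k ≠ l) (hkm : k ≠ m) (hlm : l ≠ m) :
    ∫ ω, Real.sign (Z k ω i - Z l ω i) * Real.sign (Z k ω j - Z m ω j) ∂μ =
      2 / Real.pi * Real.arcsin (S i j / 2) := by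
  obtain ⟨hl, hu⟩ : -1 ≤ S i j ∧ S i j ≤ 1 := by
    have := abs_apply_le_half_add hS i j
    rw [hdiag, hdiag] at this
    exact abs_le.1 (this.trans (by norm_num))
  have M := memLp_coord hZ
  have hint : ∀ k i, Integrable (fun ω => Z k ω i) μ := fun k i =>
    (M k i).integrable (by norm_num)
  refine integral_sign_mul_sign_of_gaussian (v := 2) (hasGaussianLaw_diff hZ hind k l m i j)
    ?_ ?_ (by norm_num) (Real.neg_pi_div_two_lt_arcsin.2 (by linarith))
    (Real.arcsin_lt_pi_div_two.2 (by linarith)) ?_ ?_ ?_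
  · rw [integral_sub (hint _ _) (hint _ _), integral_coord hS hZ, integral_coord hS hZ, sub_zero]
  · rw [integral_sub (hint _ _) (hint _ _), integral_coord hS hZ, integral_coord hS hZ, sub_zero]
  · rw [covariance_fun_sub_fun_sub (M _ _) (M _ _) (M _ _) (M _ _), covariance_same hS hZ,
      covariance_same hS hZ, covariance_ne hZ hind hkl, covariance_ne hZ hind hkl.symm, hdiag]
    norm_num
  · rw [covariance_fun_sub_fun_sub (M _ _) (M _ _) (M _ _) (M _ _), covariance_same hS hZ,
      covariance_same hS hZ, covariance_ne hZ hind hkm, covariance_ne hZ hind hkm.symm, hdiag]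
    norm_num
  · rw [covariance_fun_sub_fun_sub (M _ _) (M _ _) (M _ _) (M _ _), covariance_same hS hZ,
      covariance_ne hZ hind hkm, covariance_ne hZ hind hkl.symm, covariance_ne hZ hind hlm,
      Real.sin_arcsin (by linarith) (by linarith)]
    ring

/-- Almost surely there are no ties. -/
lemma ae_ne [IsProbabilityMeasure μ] (hS : S.PosSemidef) (hdiag : ∀ j, S j j = 1)
    (hZ : ∀ k, HasLaw (Z k) (multivariateGaussian 0 S) μ) (hind : iIndepFun Z μ)
    {k l : Fin n} (hkl : k ≠ l) (i : Fin p) : ∀ᵐ ω ∂μ, Z k ω i ≠ Z l ω i := by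
  have M := memLp_coord hZ
  have hG := (hasGaussianLaw_diff hZ hind k l l i i).fst
  have hvar : Var[fun ω => Z k ω i - Z l ω i; μ] = 2 := by
    rw [← covariance_self hG.aemeasurable,
      covariance_fun_sub_fun_sub (M _ _) (M _ _) (M _ _) (M _ _), covariance_same hS hZ,
      covariance_same hS hZ, covariance_ne hZ hind hkl, covariance_ne hZ hind hkl.symm, hdiag]
    norm_num
  have hlaw := hG.map_eq_gaussianReal
  rw [hvar] at hlaw
  have := nullSingletonClass_gaussianReal (μ := ∫ ω, (Z k ω i - Z l ω i) ∂μ)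
    (v := (2 : ℝ).toNNReal) (by simp)
  have h0 : ∀ᵐ y ∂(μ.map fun ω => Z k ω i - Z l ω i), y ≠ 0 := by
    rw [hlaw, ae_iff, show {y : ℝ | ¬ y ≠ 0} = {0} by ext; simp]
    exact measure_singleton 0
  filter_upwards [ae_of_ae_map hG.aemeasurable h0] with ω hω
  exact sub_ne_zero.1 hω

end Gaussian

/-! ### Rank correlations through signs -/

section Ranks

variable {n p : ℕ}

lemma rank_congr {v w : Fin n → ℝ} (h : ∀ k l, v k < v l ↔ w k < w l) : rank v = rank w := by
  ext k
  have h' : ∀ k l, v k ≤ v l ↔ w k ≤ w l := fun k l => by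
    rw [← not_lt, ← not_lt, h]
  simp only [rank, h, h']

lemma rankCorr_congr {x y : Fin n → Fin p → ℝ} (h : ∀ i k l, x k i < x l i ↔ y k i < y l i) :
    rankCorr x = rankCorr y := by
  have : ∀ i, rank (fun k => x k i) = rank (fun k => y k i) := fun i => rank_congr (h i)
  simp only [rankCorr, spearman, this]

lemma rankCorr_transpose (x : Fin n → Fin p → ℝ) : (rankCorr x).transpose = rankCorr x := by
  ext i j
  simp only [rankCorr, Matrix.transpose_apply, Matrix.of_apply, spearman, pearson]
  simp only [mul_comm]

/-- The centred rank, up to a factor two, as a sum of signs. -/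
noncomputable def signSum (v : Fin n → ℝ) (k : Fin n) : ℝ := ∑ l, Real.sign (v k - v l)

lemma realSign_sub (a b : ℝ) :
    Real.sign (a - b) = (if b < a then 1 else 0) + (if b ≤ a then 1 else 0) - 1 := by
  rcases lt_trichotomy a b with h | h | h
  · rw [Real.sign_of_neg (sub_neg.2 h), if_neg (not_lt.2 h.le), if_neg (not_le.2 h)]; norm_num
  · subst h; simp
  · rw [Real.sign_of_pos (sub_pos.2 h), if_pos h, if_pos h.le]; norm_num

lemma signSum_eq (v : Fin n → ℝ) (k : Fin n) :
    signSum v k = ((Finset.univ.filter fun l => v l < v k).card : ℝ)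
      + ((Finset.univ.filter fun l => v l ≤ v k).card : ℝ) - n := by
  simp only [signSum, realSign_sub, Finset.sum_sub_distrib, Finset.sum_add_distrib,
    Finset.sum_boole]
  simp

lemma rank_eq (v : Fin n → ℝ) (k : Fin n) : rank v k = (signSum v k + n + 1) / 2 := by
  rw [signSum_eq, rank]; ring

lemma sum_signSum (v : Fin n → ℝ) : ∑ k, signSum v k = 0 := by
  have h1 : ∑ k, signSum v k = -∑ k, signSum v k := by
    simp only [signSum]
    conv_lhs => rw [Finset.sum_comm]
    rw [← Finset.sum_neg_distrib]
    refine Finset.sum_congr rfl fun k _ => ?_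
    rw [← Finset.sum_neg_distrib]
    refine Finset.sum_congr rfl fun l _ => ?_
    rw [← realSign_neg, neg_sub]
  linarith

lemma rank_sub_mean (hn : n ≠ 0) (v : Fin n → ℝ) (k : Fin n) :
    rank v k - mean (rank v) = signSum v k / 2 := by
  have hn' : (n : ℝ) ≠ 0 := by exact_mod_cast hn
  have h1 : mean (rank v) = (n + 1) / 2 := by
    simp only [mean, rank_eq, ← Finset.sum_div, Finset.sum_add_distrib, sum_signSum]
    simp
    field_simp
  rw [h1, rank_eq]; ring

lemma sum_range_sq_centred (n : ℕ) (N : ℝ) :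
    ∑ c ∈ Finset.range n, (2 * (c : ℝ) + 1 - N) ^ 2 =
      n * (4 * n ^ 2 - 1) / 3 - 2 * N * n ^ 2 + N ^ 2 * n := by
  induction n with
  | zero => simp
  | succ n ih => rw [Finset.sum_range_succ, ih]; push_cast; ring

/-- Without ties the ranks are a permutation of `1, …, n`. -/
lemma sum_signSum_sq {v : Fin n → ℝ} (hv : Function.Injective v) :
    ∑ k, signSum v k ^ 2 = n * ((n : ℝ) ^ 2 - 1) / 3 := by
  have hlt : ∀ k, (Finset.univ.filter fun l => v l < v k).card < n := by
    intro k
    have h1 : (Finset.univ.filter fun l => v l < v k) ⊂ Finset.univ :=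
      Finset.filter_ssubset.2 ⟨k, Finset.mem_univ k, lt_irrefl _⟩
    simpa using Finset.card_lt_card h1
  set c : Fin n → Fin n := fun k => ⟨_, hlt k⟩ with hc
  have hmono : ∀ k k', v k < v k' → c k < c k' := by
    intro k k' hkk
    suffices h : (Finset.univ.filter fun l => v l < v k) ⊂
        (Finset.univ.filter fun l => v l < v k') from Finset.card_lt_card h
    rw [Finset.ssubset_iff_of_subset]
    · exact ⟨k, by simpa using hkk, by simp⟩
    · intro l hl
      simp only [Finset.mem_filter, Finset.mem_univ, true_and] at hl ⊢
      exact hl.trans hkk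
  have hinj : Function.Injective c := by
    intro k k' h
    by_contra hne
    rcases lt_or_gt_of_ne (hv.ne hne) with h1 | h1
    · exact (hmono _ _ h1).ne h
    · exact (hmono _ _ h1).ne' h
  have hs : ∀ k, signSum v k = 2 * ((c k : ℕ) : ℝ) + 1 - n := by
    intro k
    have h1 : (Finset.univ.filter fun l => v l ≤ v k) =
        insert k (Finset.univ.filter fun l => v l < v k) := by
      ext l
      simp only [Finset.mem_filter, Finset.mem_univ, true_and, Finset.mem_insert]
      rw [le_iff_lt_or_eq, or_comm, hv.eq_iff]
    rw [signSum_eq, h1, Finset.card_insert_of_notMem (by simp)]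
    simp only [hc]
    push_cast; ring
  rw [Finset.sum_congr rfl fun k _ => by rw [hs k],
    (Finite.injective_iff_bijective.1 hinj).sum_comp
      (fun a : Fin n => (2 * ((a : ℕ) : ℝ) + 1 - n) ^ 2),
    Fin.sum_univ_eq_sum_range (fun a => (2 * (a : ℝ) + 1 - n) ^ 2), sum_range_sq_centred]
  ring

lemma spearman_eq (hn : 2 ≤ n) {x : Fin n → Fin p → ℝ}
    (hx : ∀ i, Function.Injective fun k => x k i) (i j : Fin p) :
    spearman x i j = 3 / (n * ((n : ℝ) ^ 2 - 1)) *
      ∑ k, signSum (fun k => x k i) k * signSum (fun k => x k j) k := by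
  have hn2 : (2 : ℝ) ≤ n := by exact_mod_cast hn
  have hN : 0 < n * ((n : ℝ) ^ 2 - 1) / 3 / 4 := by
    have : 0 < (n : ℝ) ^ 2 - 1 := by nlinarith
    positivity
  have hn0 : n ≠ 0 := by omega
  have hsq : ∀ i, ∑ k, (rank (fun k => x k i) k - mean (rank fun k => x k i)) ^ 2 =
      n * ((n : ℝ) ^ 2 - 1) / 3 / 4 := by
    intro i
    rw [← sum_signSum_sq (hx i), Finset.sum_div]
    refine Finset.sum_congr rfl fun k _ => ?_
    rw [rank_sub_mean hn0]; ring
  have hprod : ∑ k, (rank (fun k => x k i) k - mean (rank fun k => x k i)) *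
      (rank (fun k => x k j) k - mean (rank fun k => x k j)) =
      (∑ k, signSum (fun k => x k i) k * signSum (fun k => x k j) k) / 4 := by
    rw [Finset.sum_div]
    refine Finset.sum_congr rfl fun k _ => ?_
    rw [rank_sub_mean hn0, rank_sub_mean hn0]; ring
  rw [spearman, pearson, hsq, hsq, hprod, Real.mul_self_sqrt hN.le]
  have : (n : ℝ) ^ 2 - 1 ≠ 0 := by nlinarith
  field_simp

lemma rankCorr_diag (hn : 2 ≤ n) {x : Fin n → Fin p → ℝ}
    (hx : ∀ i, Function.Injective fun k => x k i) (i : Fin p) : rankCorr x i i = 1 := by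
  have hn2 : (2 : ℝ) ≤ n := by exact_mod_cast hn
  have h1 : spearman x i i = 1 := by
    rw [spearman_eq hn hx]
    simp only [← sq]
    rw [sum_signSum_sq (hx i)]
    have : (n : ℝ) ^ 2 - 1 ≠ 0 := by nlinarith
    field_simp
  rw [rankCorr, Matrix.of_apply, h1, mul_one, Real.sin_pi_div_six]
  norm_num

/-- The triples of distinct indices. -/
def distinctTriples (n : ℕ) : Finset (Fin n × Fin n × Fin n) :=
  Finset.univ.filter fun t => t.1 ≠ t.2.1 ∧ t.1 ≠ t.2.2 ∧ t.2.1 ≠ t.2.2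

lemma card_compl_distinctTriples_le (n : ℕ) :
    ((distinctTriples n)ᶜ.card : ℝ) ≤ 3 * (n : ℝ) ^ 2 := by
  have h : (distinctTriples n)ᶜ ⊆
      (Finset.univ.image fun t : Fin n × Fin n => (t.1, t.1, t.2)) ∪
      ((Finset.univ.image fun t : Fin n × Fin n => (t.1, t.2, t.1)) ∪
      (Finset.univ.image fun t : Fin n × Fin n => (t.1, t.2, t.2))) := by
    rintro ⟨a, b, c⟩ ht
    simp only [distinctTriples, Finset.mem_compl, Finset.mem_filter, Finset.mem_univ, true_and,
      not_and_or, not_not, ne_eq] at ht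
    simp only [Finset.mem_union, Finset.mem_image, Finset.mem_univ, true_and, Prod.exists,
      Prod.mk.injEq]
    rcases ht with h | h | h
    · exact Or.inl ⟨a, c, rfl, h, rfl⟩
    · exact Or.inr (Or.inl ⟨a, b, rfl, rfl, h⟩)
    · exact Or.inr (Or.inr ⟨a, b, rfl, rfl, h⟩)
  have hc : ∀ f : Fin n × Fin n → Fin n × Fin n × Fin n, (Finset.univ.image f).card ≤ n ^ 2 := by
    intro f
    refine Finset.card_image_le.trans ?_
    simp [sq]
  have h2 := (Finset.card_le_card h).trans ((Finset.card_union_le _ _).trans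
    (Nat.add_le_add (hc _) ((Finset.card_union_le _ _).trans (Nat.add_le_add (hc _) (hc _)))))
  have h3 : (distinctTriples n)ᶜ.card ≤ 3 * n ^ 2 := by omega
  exact_mod_cast h3

/-- Spearman's correlation is, up to `O(1 / n)`, three times the average of
`sign (u_k - u_l) * sign (v_k - v_m)` over the triples `(k, l, m)` of distinct indices; the average
enters through `W`. -/
lemma abs_spearman_sub_le (hn : 2 ≤ n) {x : Fin n → Fin p → ℝ}
    (hx : ∀ i, Function.Injective fun k => x k i) (i j : Fin p) {W θ : ℝ} (hθ : |θ| ≤ 1)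
    (hW : ∑ t ∈ distinctTriples n, Real.sign (x t.1 i - x t.2.1 i) *
      Real.sign (x t.1 j - x t.2.2 j) = (distinctTriples n).card * W) :
    |spearman x i j - 3 * θ| ≤ 4 * |W - θ| + 26 / n := by
  have hn2 : (2 : ℝ) ≤ n := by exact_mod_cast hn
  set h : Fin n × Fin n × Fin n → ℝ := fun t =>
    Real.sign (x t.1 i - x t.2.1 i) * Real.sign (x t.1 j - x t.2.2 j) with hh
  have h1 : ∑ k, signSum (fun k => x k i) k * signSum (fun k => x k j) k = ∑ t, h t := by
    rw [Fintype.sum_prod_type]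
    refine Finset.sum_congr rfl fun k _ => ?_
    rw [Fintype.sum_prod_type, signSum, signSum, Finset.sum_mul_sum]
  have h2 : ∑ t, h t = (distinctTriples n).card * W + ∑ t ∈ (distinctTriples n)ᶜ, h t := by
    rw [← hW, Finset.sum_add_sum_compl]
  set c : ℝ := ((distinctTriples n).card : ℝ) with hc
  set c' : ℝ := ((distinctTriples n)ᶜ.card : ℝ) with hc'
  have hcc : c + c' = (n : ℝ) ^ 3 := by
    rw [hc, hc']
    have := Finset.card_add_card_compl (distinctTriples n)
    rw [Fintype.card_prod, Fintype.card_prod, Fintype.card_fin] at this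
    rw [← Nat.cast_add, this]; push_cast; ring
  have hc'0 : 0 ≤ c' := Nat.cast_nonneg _
  have hc0 : 0 ≤ c := Nat.cast_nonneg _
  have hc'n : c' ≤ 3 * (n : ℝ) ^ 2 := card_compl_distinctTriples_le n
  set r := ∑ t ∈ (distinctTriples n)ᶜ, h t with hr
  have hrb : |r| ≤ c' := by
    refine (Finset.abs_sum_le_sum_abs _ _).trans ?_
    refine (Finset.sum_le_card_nsmul _ _ 1 fun t _ => ?_).trans (by simp [hc'])
    rw [hh, abs_mul]
    exact mul_le_one₀ (abs_realSign_le _) (abs_nonneg _) (abs_realSign_le _)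
  set N : ℝ := n * ((n : ℝ) ^ 2 - 1) with hN
  have hNlow : 3 / 4 * (n : ℝ) ^ 3 ≤ N := by rw [hN]; nlinarith
  have hN0 : 0 < N := lt_of_lt_of_le (by positivity) hNlow
  rw [spearman_eq hn hx, h1, h2]
  have e : 3 / N * (c * W + r) - 3 * θ = 3 / N * (c * (W - θ) + (r + (c - N) * θ)) := by
    field_simp; ring
  rw [e, abs_mul, abs_of_pos (by positivity : 0 < 3 / N)]
  have hcN : c - N = n - c' := by rw [hN]; linear_combination hcc
  have b1 : |(c - N) * θ| ≤ n + c' := by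
    rw [abs_mul, hcN]
    calc |(n : ℝ) - c'| * |θ| ≤ (n + c') * 1 := by
          refine mul_le_mul ?_ hθ (abs_nonneg _) (by positivity)
          rw [abs_le]; constructor <;> linarith
      _ = _ := mul_one _
  have b2 : |c * (W - θ) + (r + (c - N) * θ)| ≤ c * |W - θ| + (n + 2 * c') := by
    refine (abs_add_le _ _).trans (add_le_add ?_ ?_)
    · rw [abs_mul, abs_of_nonneg hc0]
    · refine (abs_add_le _ _).trans ?_
      linarith
  calc _ ≤ 3 / N * (c * |W - θ| + (n + 2 * c')) :=
        mul_le_mul_of_nonneg_left b2 (by positivity)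
    _ ≤ 3 / N * ((n : ℝ) ^ 3 * |W - θ| + 13 / 2 * (n : ℝ) ^ 2) := by
        refine mul_le_mul_of_nonneg_left (add_le_add ?_ ?_) (by positivity)
        · exact mul_le_mul_of_nonneg_right (by linarith) (abs_nonneg _)
        · nlinarith
    _ ≤ 3 / (3 / 4 * (n : ℝ) ^ 3) * ((n : ℝ) ^ 3 * |W - θ| + 13 / 2 * (n : ℝ) ^ 2) := by
        gcongr
    _ = 4 * |W - θ| + 26 / n := by field_simp; ring

end Ranks

/-! ### Hoeffding's inequality for `U`-statistics -/

section UStatistic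

variable {Ω : Type*} [MeasurableSpace Ω] {μ : Measure Ω}

/-- Disjoint blocks of independent random variables are independent. -/
lemma iIndepFun_curry {ι κ E : Type*} [MeasurableSpace E] {X : ι → κ → Ω → E}
    (mX : ∀ i j, Measurable (X i j))
    (h : iIndepFun (fun (q : (_ : ι) × κ) ω => X q.1 q.2 ω) μ) :
    iIndepFun (fun i ω => (X i · ω)) μ := by
  have := h.isProbabilityMeasure
  have : ∀ i j, IsProbabilityMeasure (μ.map (X i j)) :=
    fun i j => Measure.isProbabilityMeasure_map (mX i j).aemeasurable
  have h2 : ∀ i, iIndepFun (X i) μ := fun i =>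
    h.precomp (g := fun j : κ => (⟨i, j⟩ : (_ : ι) × κ)) fun j j' hj => by
      simp only [Sigma.mk.injEq, heq_eq_eq, true_and] at hj; exact hj
  have e : (MeasurableEquiv.piCurry fun (_ : ι) (_ : κ) => E) ∘
      (fun ω (q : (_ : ι) × κ) => X q.1 q.2 ω) = fun ω i j => X i j ω := by
    ext; simp [Sigma.curry]
  rw [iIndepFun_iff_map_fun_eq_infinitePi_map (by fun_prop)]
  rw [← e, ← Measure.map_map (by fun_prop) (by fun_prop),
    (iIndepFun_iff_map_fun_eq_infinitePi_map (by fun_prop)).1 h,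
    Measure.infinitePi_map_piCurry (fun i j => μ.map (X i j))]
  congrm Measure.infinitePi fun i => ?_
  rw [(iIndepFun_iff_map_fun_eq_infinitePi_map (by fun_prop)).1 (h2 i)]

lemma hasSubgaussianMGF_const_mul {X : Ω → ℝ} {c c' : NNReal} (h : HasSubgaussianMGF X c μ) (r : ℝ)
    (hc : (c' : ℝ) = r ^ 2 * c) : HasSubgaussianMGF (fun ω => r * X ω) c' μ := by
  have h1 := h.const_mul r
  convert h1 using 1
  exact NNReal.eq (hc.trans rfl)

/-- Averages of arbitrarily dependent sub-Gaussian variables are sub-Gaussian, with the same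
parameter. -/
lemma hasSubgaussianMGF_average [IsProbabilityMeasure μ] {ι : Type*} {s : Finset ι}
    (hs : s.Nonempty) {X : ι → Ω → ℝ} {c : NNReal} (h : ∀ i ∈ s, HasSubgaussianMGF (X i) c μ) :
    HasSubgaussianMGF (fun ω => (s.card : ℝ)⁻¹ * ∑ i ∈ s, X i ω) c μ := by
  classical
  have key : ∀ t ⊆ s, HasSubgaussianMGF (fun ω => ∑ i ∈ t, X i ω)
      ((t.card * NNReal.sqrt c) ^ 2) μ := by
    intro t
    induction t using Finset.induction_on with
    | empty => intro _; simp
    | insert a t ha ih =>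
      intro hts
      have h1 := ih fun i hi => hts (Finset.mem_insert_of_mem hi)
      have h2 := h a (hts (Finset.mem_insert_self a t))
      have h3 := h2.add h1
      simp only [Finset.sum_insert ha, Finset.card_insert_of_notMem ha]
      convert h3 using 1
      rw [NNReal.sqrt_sq]
      push_cast; ring
  have : (s.card : ℝ) ≠ 0 := by exact_mod_cast hs.card_pos.ne'
  refine hasSubgaussianMGF_const_mul (key s subset_rfl) _ ?_
  rw [mul_pow, NNReal.sq_sqrt]
  push_cast
  field_simp

variable {E : Type*} [MeasurableSpace E] {n : ℕ}

lemma vecCons_injective {k l j : Fin n} (hkl : k ≠ l) (hkj : k ≠ j) (hlj : l ≠ j) :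
    Function.Injective ![k, l, j] := by
  intro c c' h
  fin_cases c <;> fin_cases c' <;> simp_all [eq_comm]

/-- The sum over triples of distinct indices does not depend on a permutation of the indices, and
the sum over permutations does not depend on the triple. -/
lemma card_perm_mul_sum (g : Fin n → Fin n → Fin n → ℝ) {a : Fin 3 → Fin n}
    (ha : Function.Injective a) :
    (distinctTriples n).card * ∑ π : Equiv.Perm (Fin n), g (π (a 0)) (π (a 1)) (π (a 2)) =
      Fintype.card (Equiv.Perm (Fin n)) * ∑ t ∈ distinctTriples n, g t.1 t.2.1 t.2.2 := by
  have h1 : ∀ t ∈ distinctTriples n, ∑ π : Equiv.Perm (Fin n), g (π t.1) (π t.2.1) (π t.2.2) =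
      ∑ π : Equiv.Perm (Fin n), g (π (a 0)) (π (a 1)) (π (a 2)) := by
    rintro ⟨k, l, j⟩ ht
    simp only [distinctTriples, Finset.mem_filter, Finset.mem_univ, true_and] at ht
    obtain ⟨ρ, hρ⟩ := Equiv.Perm.exists_extending_pair a ![k, l, j] ha
      (vecCons_injective ht.1 ht.2.1 ht.2.2)
    have r0 : ρ (a 0) = k := hρ 0
    have r1 : ρ (a 1) = l := hρ 1
    have r2 : ρ (a 2) = j := hρ 2
    simp only [← r0, ← r1, ← r2]
    exact Equiv.sum_comp (Equiv.mulRight ρ)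
      fun π : Equiv.Perm (Fin n) => g (π (a 0)) (π (a 1)) (π (a 2))
  have h2 : ∀ π : Equiv.Perm (Fin n), ∑ t ∈ distinctTriples n, g (π t.1) (π t.2.1) (π t.2.2) =
      ∑ t ∈ distinctTriples n, g t.1 t.2.1 t.2.2 := by
    intro π
    refine Finset.sum_equiv (π.prodCongr (π.prodCongr π)) (fun t => ?_) (fun t _ => rfl)
    simp [distinctTriples]
  calc _ = ∑ t ∈ distinctTriples n, ∑ π : Equiv.Perm (Fin n), g (π t.1) (π t.2.1) (π t.2.2) := by
        rw [Finset.sum_congr rfl h1, Finset.sum_const, nsmul_eq_mul]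
    _ = _ := by
        rw [Finset.sum_comm, Finset.sum_congr rfl fun π _ => h2 π, Finset.sum_const, nsmul_eq_mul,
          Finset.card_univ]

/-- Hoeffding's representation of a `U`-statistic of order three as an average, over permutations,
of averages over `m` disjoint blocks. -/
lemma exists_ustatistic [IsProbabilityMeasure μ] {Z : Fin n → Ω → E} (hZ : ∀ k, Measurable (Z k))
    (hind : iIndepFun Z μ) {h : E → E → E → ℝ}
    (hmeas : Measurable fun z : E × E × E => h z.1 z.2.1 z.2.2) (hb : ∀ x y z, |h x y z| ≤ 1)
    {θ : ℝ} (hθ : ∀ k l m, k ≠ l → k ≠ m → l ≠ m →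
      ∫ ω, h (Z k ω) (Z l ω) (Z m ω) ∂μ = θ)
    {m : ℕ} (hm : 0 < m) (hmn : m * 3 ≤ n) :
    ∃ W : Ω → ℝ,
      (∀ ω, ∑ t ∈ distinctTriples n, h (Z t.1 ω) (Z t.2.1 ω) (Z t.2.2 ω) =
        (distinctTriples n).card * W ω) ∧
      HasSubgaussianMGF (fun ω => W ω - θ) (m : NNReal)⁻¹ μ := by
  set e : Fin m → Fin 3 → Fin n := fun b c => Fin.castLE hmn (finProdFinEquiv (b, c)) with he
  have he_inj : ∀ b c b' c', e b c = e b' c' → b = b' ∧ c = c' := by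
    intro b c b' c' hbc
    have h1 := finProdFinEquiv.injective (Fin.castLE_injective hmn hbc)
    simpa using h1
  set F : Equiv.Perm (Fin n) → Fin n → Fin n → Fin n → Ω → ℝ := fun π k l j ω =>
    h (Z (π k) ω) (Z (π l) ω) (Z (π j) ω) with hF
  set V : Equiv.Perm (Fin n) → Ω → ℝ := fun π ω =>
    (m : ℝ)⁻¹ * ∑ b, (F π (e b 0) (e b 1) (e b 2) ω - θ) with hV
  have hm0 : (m : ℝ) ≠ 0 := by exact_mod_cast hm.ne'
  have hne : ∀ (π : Equiv.Perm (Fin n)) b c c', c ≠ c' → π (e b c) ≠ π (e b c') :=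
    fun π b c c' hcc hπ => hcc (he_inj b c b c' (π.injective hπ)).2
  have hsub : ∀ π, HasSubgaussianMGF (V π) (m : NNReal)⁻¹ μ := by
    intro π
    have hblock : iIndepFun (fun b ω => F π (e b 0) (e b 1) (e b 2) ω - θ) μ := by
      have h1 : iIndepFun (fun (q : (_ : Fin m) × Fin 3) ω => Z (π (e q.1 q.2)) ω) μ :=
        hind.precomp (g := fun q : (_ : Fin m) × Fin 3 => π (e q.1 q.2)) fun q q' hqq => by
          obtain ⟨h1, h2⟩ := he_inj _ _ _ _ (π.injective hqq)
          obtain ⟨b, c⟩ := q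
          obtain ⟨b', c'⟩ := q'
          simp only at h1 h2
          rw [h1, h2]
      have h2 := iIndepFun_curry (X := fun b c => Z (π (e b c))) (fun b c => hZ _) h1
      have hcm : Measurable fun y : Fin 3 → E => h (y 0) (y 1) (y 2) - θ :=
        (hmeas.comp (g := fun z : E × E × E => h z.1 z.2.1 z.2.2)
          (f := fun y : Fin 3 → E => (y 0, y 1, y 2)) (by fun_prop)).sub_const θ
      exact h2.comp (fun _ y => h (y 0) (y 1) (y 2) - θ) (fun _ => hcm)
    have hone : ∀ b ∈ (Finset.univ : Finset (Fin m)),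
        HasSubgaussianMGF (fun ω => F π (e b 0) (e b 1) (e b 2) ω - θ) 1 μ := by
      intro b _
      have hFm : Measurable (F π (e b 0) (e b 1) (e b 2)) :=
        hmeas.comp ((hZ _).prodMk ((hZ _).prodMk (hZ _)))
      have h1 := hasSubgaussianMGF_of_mem_Icc (μ := μ) (a := -1) (b := 1) hFm.aemeasurable
        (Filter.Eventually.of_forall fun ω => abs_le.1 (hb _ _ _))
      have h2 : ∫ ω, F π (e b 0) (e b 1) (e b 2) ω ∂μ = θ :=
        hθ _ _ _ (hne π b 0 1 (by decide)) (hne π b 0 2 (by decide)) (hne π b 1 2 (by decide))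
      rw [h2] at h1
      convert h1 using 1
      ext
      norm_num
    refine hasSubgaussianMGF_const_mul (HasSubgaussianMGF.sum_of_iIndepFun hblock hone) _ ?_
    simp only [Finset.sum_const, Finset.card_univ, Fintype.card_fin, NNReal.coe_inv,
      NNReal.coe_natCast, nsmul_eq_mul, mul_one]
    field_simp
  set M : ℝ := (Fintype.card (Equiv.Perm (Fin n)) : ℝ) with hM
  have hM0 : M ≠ 0 := by rw [hM]; exact_mod_cast Fintype.card_ne_zero
  refine ⟨fun ω => M⁻¹ * ∑ π, V π ω + θ, fun ω => ?_, ?_⟩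
  · have h3 : ∀ b, ((distinctTriples n).card : ℝ) * ∑ π, F π (e b 0) (e b 1) (e b 2) ω =
        M * ∑ t ∈ distinctTriples n, h (Z t.1 ω) (Z t.2.1 ω) (Z t.2.2 ω) := fun b =>
      card_perm_mul_sum (fun k l j => h (Z k ω) (Z l ω) (Z j ω))
        (a := e b) fun c c' hcc => (he_inj b c b c' hcc).2
    have h4 : ∑ π, V π ω = (m : ℝ)⁻¹ * ∑ b, ∑ π, F π (e b 0) (e b 1) (e b 2) ω - M * θ := by
      simp only [hV]
      rw [← Finset.mul_sum, Finset.sum_comm]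
      simp only [Finset.sum_sub_distrib, Finset.sum_const, Finset.card_univ, nsmul_eq_mul,
        Fintype.card_fin]
      rw [mul_sub, ← hM]
      field_simp
    have h5 : ((distinctTriples n).card : ℝ) * ∑ b, ∑ π, F π (e b 0) (e b 1) (e b 2) ω =
        m * (M * ∑ t ∈ distinctTriples n, h (Z t.1 ω) (Z t.2.1 ω) (Z t.2.2 ω)) := by
      rw [Finset.mul_sum, Finset.sum_congr rfl fun b _ => h3 b, Finset.sum_const,
        Finset.card_univ, Fintype.card_fin, nsmul_eq_mul]
    change _ = _ * (M⁻¹ * ∑ π, V π ω + θ)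
    rw [h4]
    field_simp
    linear_combination -h5
  · have h1 := hasSubgaussianMGF_average (s := (Finset.univ : Finset (Equiv.Perm (Fin n))))
      Finset.univ_nonempty (fun π _ => hsub π)
    simpa [hM, Finset.card_univ] using h1

end UStatistic

/-! ### Concentration of the rank correlation matrix -/

section Concentration

variable {Ω : Type*} [MeasurableSpace Ω] {μ : Measure Ω} [IsProbabilityMeasure μ]
  {n p : ℕ} {S : Matrix (Fin p) (Fin p) ℝ}

/-- The correction `2 sin (π r / 6)` turns the limit `(6 / π) arcsin (σ / 2)` of Spearman's
correlation into `σ`. -/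
lemma abs_rankCorr_sub_le (hn : 2 ≤ n) {x : Fin n → Fin p → ℝ}
    (hx : ∀ i, Function.Injective fun k => x k i) (i j : Fin p) (hS : |S i j| ≤ 1) {W : ℝ}
    (hW : ∑ t ∈ distinctTriples n, Real.sign (x t.1 i - x t.2.1 i) *
      Real.sign (x t.1 j - x t.2.2 j) = (distinctTriples n).card * W) :
    |rankCorr x i j - S i j| ≤
      5 * |W - 2 / Real.pi * Real.arcsin (S i j / 2)| + 28 / n := by
  obtain ⟨hl, hu⟩ := abs_le.1 hS
  set θ := 2 / Real.pi * Real.arcsin (S i j / 2) with hθ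
  have hpi := Real.pi_pos
  have hθ1 : |θ| ≤ 1 := by
    have h1 : |Real.arcsin (S i j / 2)| ≤ Real.pi / 2 :=
      abs_le.2 ⟨Real.neg_pi_div_two_le_arcsin _, Real.arcsin_le_pi_div_two _⟩
    rw [hθ, abs_mul, abs_of_pos (by positivity : 0 < 2 / Real.pi)]
    calc _ ≤ 2 / Real.pi * (Real.pi / 2) := mul_le_mul_of_nonneg_left h1 (by positivity)
      _ = 1 := by field_simp
  have h1 := abs_spearman_sub_le hn hx i j hθ1 hW
  have h2 : S i j = 2 * Real.sin (Real.pi / 6 * (3 * θ)) := by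
    have : Real.pi / 6 * (3 * θ) = Real.arcsin (S i j / 2) := by rw [hθ]; field_simp; norm_num
    rw [this, Real.sin_arcsin (by linarith) (by linarith)]; ring
  have h3 : |rankCorr x i j - S i j| ≤ Real.pi / 3 * |spearman x i j - 3 * θ| := by
    rw [rankCorr, Matrix.of_apply, h2, ← mul_sub, abs_mul, abs_two]
    have := Real.abs_sin_sub_sin_le (Real.pi / 6 * spearman x i j) (Real.pi / 6 * (3 * θ))
    rw [← mul_sub, abs_mul, abs_of_pos (by positivity : 0 < Real.pi / 6)] at this
    linarith
  have hpi2 : Real.pi / 3 ≤ 21 / 20 := by linarith [Real.pi_lt_d2]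
  have hn0 : (0 : ℝ) < n := by exact_mod_cast (by omega : 0 < n)
  calc _ ≤ Real.pi / 3 * |spearman x i j - 3 * θ| := h3
    _ ≤ 21 / 20 * (4 * |W - θ| + 26 / n) := mul_le_mul hpi2 h1 (abs_nonneg _) (by norm_num)
    _ = 21 / 5 * |W - θ| + 273 / 10 / n := by ring
    _ ≤ _ := by gcongr <;> norm_num

variable {Z : Fin n → Ω → EuclideanSpace ℝ (Fin p)}

lemma ae_injective (hS : S.PosSemidef) (hdiag : ∀ j, S j j = 1)
    (hZ : ∀ k, HasLaw (Z k) (multivariateGaussian 0 S) μ) (hind : iIndepFun Z μ) :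
    ∀ᵐ ω ∂μ, ∀ i, Function.Injective fun k => Z k ω i := by
  have h1 : ∀ᵐ ω ∂μ, ∀ (i : Fin p) (q : {q : Fin n × Fin n // q.1 ≠ q.2}),
      Z q.1.1 ω i ≠ Z q.1.2 ω i := by
    rw [ae_all_iff]; intro i
    rw [ae_all_iff]; intro q
    exact ae_ne hS hdiag hZ hind q.2 i
  filter_upwards [h1] with ω hω i k l hkl
  by_contra hne
  exact hω i ⟨(k, l), hne⟩ hkl

/-- Exponential concentration of the adjusted Spearman correlation of Gaussian data. When
`n * ε ^ 2` is bounded the claim is trivial, and otherwise the `O(1 / n)` bias of Spearman's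
correlation is absorbed by `ε`: the constant `1 / 4096` is small enough for a nontrivial claim to
force `28 / n ≤ ε / 2`. -/
lemma rankCorr_concentration (hn : 2 ≤ n) (hS : S.PosSemidef) (hdiag : ∀ j, S j j = 1)
    (hZm : ∀ k, Measurable (Z k))
    (hZ : ∀ k, HasLaw (Z k) (multivariateGaussian 0 S) μ) (hind : iIndepFun Z μ)
    (i j : Fin p) {ε : ℝ} (hε : 0 < ε) :
    μ.real {ω | ε < |rankCorr (fun k i => Z k ω i) i j - S i j|} ≤
      2 * Real.exp (-(1 / 4096 * n * ε ^ 2)) := by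
  have hij : |S i j| ≤ 1 := by
    have := abs_apply_le_half_add hS i j
    rw [hdiag, hdiag] at this
    linarith
  have hn2 : (2 : ℝ) ≤ n := by exact_mod_cast hn
  by_cases htriv : 1 / 4096 * n * ε ^ 2 ≤ Real.log 2
  · have h1 : Real.exp (-Real.log 2) ≤ Real.exp (-(1 / 4096 * n * ε ^ 2)) :=
      Real.exp_le_exp.2 (by linarith)
    rw [Real.exp_neg, Real.exp_log (by norm_num)] at h1
    have h2 : μ.real {ω | ε < |rankCorr (fun k i => Z k ω i) i j - S i j|} ≤ 1 :=
      measureReal_le_one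
    linarith
  have hlog := Real.log_two_gt_d9
  have hbig : 2800 < n * ε ^ 2 := by
    have := not_le.1 htriv
    nlinarith
  rcases Nat.lt_or_ge n 3 with hn3 | hn3
  · -- With two observations the deviation cannot be that large.
    have hn' : n = 2 := by omega
    have h3 : 3 < ε := by
      rw [hn'] at hbig
      push_cast at hbig
      nlinarith
    have hempty : {ω | ε < |rankCorr (fun k i => Z k ω i) i j - S i j|} = ∅ := by
      ext ω
      simp only [Set.mem_ofPred_eq, Set.mem_empty_iff_false, iff_false, not_lt]
      have h1 : |rankCorr (fun k i => Z k ω i) i j| ≤ 2 := by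
        rw [rankCorr, Matrix.of_apply, abs_mul, abs_two]
        linarith [Real.abs_sin_le_one (Real.pi / 6 * spearman (fun k i => Z k ω i) i j)]
      linarith [abs_sub (rankCorr (fun k i => Z k ω i) i j) (S i j)]
    rw [hempty, measureReal_empty]
    positivity
  have hm : 0 < n / 3 := Nat.div_pos hn3 (by norm_num)
  have hmn : (n : ℝ) ≤ 5 * ((n / 3 : ℕ) : ℝ) := by exact_mod_cast (by omega : n ≤ 5 * (n / 3))
  set m := n / 3 with hmdef
  set θ := 2 / Real.pi * Real.arcsin (S i j / 2) with hθ
  obtain ⟨W, hW, hsub⟩ := exists_ustatistic (μ := μ) (θ := θ) hZm hind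
    (h := fun x y z : EuclideanSpace ℝ (Fin p) => Real.sign (x i - y i) * Real.sign (x j - z j))
    (by have := measurable_realSign; fun_prop)
    (fun x y z => by
      rw [abs_mul]; exact mul_le_one₀ (abs_realSign_le _) (abs_nonneg _) (abs_realSign_le _))
    (fun k l r h1 h2 h3 => integral_sign_diff hS hdiag i j hZ hind h1 h2 h3) hm
    (by omega : m * 3 ≤ n)
  have hbias : 28 / (n : ℝ) ≤ ε / 2 := by
    rw [div_le_iff₀ (by linarith)]
    by_contra! hlt
    have h1 : 0 < ε * n := by positivity
    have h2 : (ε * n) * (ε * n) < 56 * 56 :=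
      mul_lt_mul'' (by linarith) (by linarith) h1.le h1.le
    nlinarith
  have hsubset : {ω | ε < |rankCorr (fun k i => Z k ω i) i j - S i j|} ≤ᵐ[μ]
      ({ω | ε / 10 ≤ W ω - θ} ∪ {ω | ε / 10 ≤ -(W ω - θ)} : Set Ω) := by
    filter_upwards [ae_injective hS hdiag hZ hind] with ω hω hlt
    have h1 := abs_rankCorr_sub_le hn hω i j hij (hW ω)
    have h2 : ε < |rankCorr (fun k i => Z k ω i) i j - S i j| := hlt
    have h3 : ε / 10 ≤ |W ω - θ| := by linarith
    exact le_abs.1 h3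
  have hexp : Real.exp (-(ε / 10) ^ 2 / (2 * ((m : NNReal)⁻¹ : NNReal))) ≤
      Real.exp (-(1 / 4096 * n * ε ^ 2)) := by
    apply Real.exp_le_exp.2
    have hm0 : (m : ℝ) ≠ 0 := by exact_mod_cast hm.ne'
    have : -(ε / 10) ^ 2 / (2 * (((m : NNReal)⁻¹ : NNReal) : ℝ)) = -(m * ε ^ 2 / 200) := by
      push_cast
      field_simp
      ring
    rw [this]
    nlinarith [sq_nonneg ε, mul_le_mul_of_nonneg_right hmn (sq_nonneg ε)]
  have hε10 : 0 ≤ ε / 10 := by positivity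
  calc _ ≤ μ.real ({ω | ε / 10 ≤ W ω - θ} ∪ {ω | ε / 10 ≤ -(W ω - θ)}) :=
        ENNReal.toReal_mono (measure_ne_top _ _) (measure_mono_ae hsubset)
    _ ≤ μ.real {ω | ε / 10 ≤ W ω - θ} + μ.real {ω | ε / 10 ≤ -(W ω - θ)} :=
        measureReal_union_le _ _
    _ ≤ _ := by
        have h1 := (hsub.measure_ge_le hε10).trans hexp
        have h2 := (hsub.neg.measure_ge_le hε10).trans hexp
        simp only [Pi.neg_apply] at h2
        linarith

end Concentration

/-! ### The event of close rank correlations -/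

section Event

variable {Ω : Type*} [MeasurableSpace Ω] {μ : Measure Ω}
  {n p : ℕ} {S : Matrix (Fin p) (Fin p) ℝ} {P : Measure (Fin p → ℝ)} {X : Fin n → Ω → Fin p → ℝ}

/-- Nonparanormal observations are, coordinate by coordinate, in the same weak order as Gaussian
ones. The transformations need not be measurable, so the Gaussian variables are built from
measurable modifications. -/
lemma exists_gaussian_observations (hP : IsNonparanormal P S) (hX : ∀ k, HasLaw (X k) P μ)
    (hind : iIndepFun X μ) :
    ∃ Z : Fin n → Ω → EuclideanSpace ℝ (Fin p), (∀ k, Measurable (Z k)) ∧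
      (∀ k, HasLaw (Z k) (multivariateGaussian 0 S) μ) ∧ iIndepFun Z μ ∧
      ∀ᵐ ω ∂μ, ∀ k l i, X k ω i ≤ X l ω i → Z k ω i ≤ Z l ω i := by
  obtain ⟨f, D, hf, hD, hlaw⟩ := hP
  set g : (Fin p → ℝ) → EuclideanSpace ℝ (Fin p) :=
    fun x => WithLp.toLp 2 (fun j => f j (x j)) with hg
  have hgm := hlaw.aemeasurable.measurable_mk
  have hgae := hlaw.aemeasurable.ae_eq_mk
  set g' := hlaw.aemeasurable.mk g
  have hXae := fun k => (hX k).aemeasurable.ae_eq_mk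
  have hlawX : ∀ k, μ.map ((hX k).aemeasurable.mk (X k)) = P := fun k => by
    rw [← Measure.map_congr (hXae k), (hX k).map_eq]
  refine ⟨fun k => g' ∘ (hX k).aemeasurable.mk (X k),
    fun k => hgm.comp (hX k).aemeasurable.measurable_mk, fun k => ⟨?_, ?_⟩, ?_, ?_⟩
  · exact (hgm.comp (hX k).aemeasurable.measurable_mk).aemeasurable
  · rw [← Measure.map_map hgm (hX k).aemeasurable.measurable_mk, hlawX,
      ← Measure.map_congr hgae, hlaw.map_eq]
  · exact (hind.congr hXae).comp (fun _ => g') fun _ => hgm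
  · have h1 : ∀ k, ∀ᵐ ω ∂μ, (∀ j, X k ω j ∈ D j) ∧ g (X k ω) = g' (X k ω) := fun k => by
      refine ae_of_ae_map (hX k).aemeasurable (p := fun x => (∀ j, x j ∈ D j) ∧ g x = g' x) ?_
      rw [(hX k).map_eq]
      exact hD.and hgae
    filter_upwards [ae_all_iff.2 h1, ae_all_iff.2 hXae] with ω h2 h3 k l i hkl
    simp only [Function.comp_apply, ← h3, ← (h2 _).2, hg]
    exact hf i ((h2 k).1 i) ((h2 l).1 i) hkl

/-- The union bound runs over the pairs `i < j` only: the diagonal of the rank correlation matrix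
is exact, and the matrix is symmetric. This pays for the factor `2` of the two-sided deviation. -/
lemma exists_event_rankCorr_close [IsProbabilityMeasure μ] (hn : 2 ≤ n)
    (hS : S.PosSemidef) (hdiag : ∀ j, S j j = 1)
    (hP : IsNonparanormal P S) (hX : ∀ k, HasLaw (X k) P μ) (hind : iIndepFun X μ)
    {ε : ℝ} (hε : 0 < ε) :
    ∃ E : Set Ω, MeasurableSet E ∧
      1 - (p : ℝ) ^ 2 * Real.exp (-(1 / 4096 * n * ε ^ 2)) ≤ μ.real E ∧
      ∀ ω ∈ E, (∀ i, rankCorr (fun k => X k ω) i i = 1) ∧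
        ∀ i j, |rankCorr (fun k => X k ω) i j - S i j| ≤ ε := by
  obtain ⟨Z, hZm, hZ, hZind, hmono⟩ := exists_gaussian_observations hP hX hind
  set good : Set Ω := {ω | (∀ i, Function.Injective fun k => Z k ω i) ∧
    ∀ k l i, X k ω i ≤ X l ω i → Z k ω i ≤ Z l ω i} with hgood
  have hgood0 : μ goodᶜ = 0 := (ae_injective hS hdiag hZ hZind).and hmono
  set T : Finset (Fin p × Fin p) := Finset.univ.filter fun q => q.1 < q.2 with hT
  have hTcard : 2 * (T.card : ℝ) ≤ (p : ℝ) ^ 2 := by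
    have h1 : Disjoint T (T.map (Equiv.prodComm _ _).toEmbedding) := by
      rw [Finset.disjoint_left]
      rintro ⟨a, b⟩ h1 h2
      simp only [hT, Finset.mem_map_equiv, Finset.mem_filter, Finset.mem_univ, true_and,
        Equiv.prodComm_symm, Equiv.prodComm_apply, Prod.swap_prod_mk] at h1 h2
      exact lt_asymm h1 h2
    have h2 := Finset.card_le_univ (T.disjUnion _ h1)
    rw [Finset.card_disjUnion, Finset.card_map, Fintype.card_prod, Fintype.card_fin] at h2
    have h3 : 2 * T.card ≤ p ^ 2 := by nlinarith
    exact_mod_cast h3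
  set dev : Fin p × Fin p → Set Ω :=
    fun q => {ω | ε < |rankCorr (fun k i => Z k ω i) q.1 q.2 - S q.1 q.2|} with hdev
  set N : Set Ω := goodᶜ ∪ ⋃ q ∈ T, dev q with hN
  have hNle : μ.real N ≤ (p : ℝ) ^ 2 * Real.exp (-(1 / 4096 * n * ε ^ 2)) := by
    calc μ.real N ≤ μ.real goodᶜ + μ.real (⋃ q ∈ T, dev q) := measureReal_union_le _ _
      _ = μ.real (⋃ q ∈ T, dev q) := by rw [measureReal_def, hgood0]; simp
      _ ≤ ∑ q ∈ T, μ.real (dev q) := measureReal_biUnion_finset_le _ _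
      _ ≤ ∑ q ∈ T, 2 * Real.exp (-(1 / 4096 * n * ε ^ 2)) := Finset.sum_le_sum fun q _ =>
          rankCorr_concentration hn hS hdiag hZm hZ hZind q.1 q.2 hε
      _ = 2 * (T.card : ℝ) * Real.exp (-(1 / 4096 * n * ε ^ 2)) := by
          rw [Finset.sum_const, nsmul_eq_mul]; ring
      _ ≤ _ := mul_le_mul_of_nonneg_right hTcard (Real.exp_nonneg _)
  refine ⟨(toMeasurable μ N)ᶜ, (measurableSet_toMeasurable μ N).compl, ?_, fun ω hω => ?_⟩
  · rw [probReal_compl_eq_one_sub (measurableSet_toMeasurable μ N), measureReal_def,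
      measure_toMeasurable, ← measureReal_def]
    linarith
  have hωN : ω ∉ N := fun h => hω (subset_toMeasurable μ N h)
  have hω1 : ω ∈ good := by
    by_contra h
    exact hωN (Or.inl h)
  obtain ⟨hinj, hle⟩ := hω1
  have hlt : ∀ i k l, X k ω i < X l ω i ↔ Z k ω i < Z l ω i := fun i k l => by
    refine ⟨fun h => lt_of_le_of_ne (hle k l i h.le) fun he => ?_, fun h => ?_⟩
    · rw [hinj i he] at h
      exact lt_irrefl _ h
    · by_contra! h'
      exact absurd (hle l k i h') (not_le.2 h)
  have hRZ : rankCorr (fun k => X k ω) = rankCorr (fun k i => Z k ω i) := rankCorr_congr hlt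
  rw [hRZ]
  have hupper : ∀ i j, i < j → |rankCorr (fun k i => Z k ω i) i j - S i j| ≤ ε := fun i j hij => by
    by_contra! h
    exact hωN (Or.inr (Set.mem_biUnion (x := (i, j)) (by simpa [hT] using hij) h))
  have hRdiag : ∀ i, rankCorr (fun k i => Z k ω i) i i = 1 := rankCorr_diag hn hinj
  refine ⟨hRdiag, fun i j => ?_⟩
  rcases lt_trichotomy i j with h | rfl | h
  · exact hupper i j h
  · rw [hRdiag, hdiag, sub_self, abs_zero]
    exact hε.le
  · have hsymm := congrFun (congrFun (rankCorr_transpose fun k i => Z k ω i) i) j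
    rw [← hsymm, Matrix.transpose_apply, ← hS.1.apply i j]
    exact hupper j i h

end Event

lemma sign_eq_of_abs_sub_lt {a b : ℝ} (h : |a - b| < |b|) :
    SignType.sign a = SignType.sign b := by
  rcases lt_trichotomy b 0 with hb | rfl | hb
  · rw [abs_of_neg hb] at h
    rw [sign_neg hb, sign_neg (by linarith [le_abs_self (a - b)])]
  · simp at h
    exact absurd h (not_lt.2 (abs_nonneg a))
  · rw [abs_of_pos hb] at h
    rw [sign_pos hb, sign_pos (by linarith [neg_abs_le (a - b)])]

end RankGlasso

theorem theorem1 :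
    ∃ c₀ : ℝ, 0 < c₀ ∧
    ∀ (n p : ℕ), 2 ≤ n →
    ∀ (S : Matrix (Fin p) (Fin p) ℝ), S.PosDef → (∀ j, S j j = 1) →
    ∀ (P : Measure (Fin p → ℝ)), RankGlasso.IsNonparanormal P S →
    ∀ (Ω : Type*) [MeasurableSpace Ω] (μ : Measure Ω) [IsProbabilityMeasure μ]
      (X : Fin n → Ω → (Fin p → ℝ)), (∀ k, HasLaw (X k) P μ) → iIndepFun X μ →
    ∀ (κ : ℝ), 0 < κ → κ < 1 → RankGlasso.irrep S < 1 - κ →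
    ∀ (lam : ℝ), 0 < lam →
    6 * (1 + κ / 4) * RankGlasso.linfNorm S * RankGlasso.KH S *
      max 1 ((1 + 4 / κ) * RankGlasso.linfNorm S ^ 2 * RankGlasso.KH S) *
      (RankGlasso.maxDegree S⁻¹ : ℝ) * lam < 1 →
    -- (a) element-wise maximal bound
    (∃ E : Set Ω, MeasurableSet E ∧
      1 - (p : ℝ) ^ 2 * Real.exp (-(κ ^ 2 / 16 * c₀ * n * lam ^ 2)) ≤ μ.real E ∧
      ∀ ω ∈ E, ∃ Θ : Matrix (Fin p) (Fin p) ℝ,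
        RankGlasso.IsRankGlasso (fun k => X k ω) lam Θ ∧
        (∀ i j, S⁻¹ i j = 0 → Θ i j = 0) ∧
        RankGlasso.maxNorm (Θ - S⁻¹) ≤ 2 * RankGlasso.KH S * (1 + κ / 4) * lam) ∧
    -- (b) graphical model selection consistency
    (((2 * (1 + κ / 4) * RankGlasso.KH S * lam : ℝ) : EReal) < RankGlasso.psiMin S⁻¹ →
      ∃ E : Set Ω, MeasurableSet E ∧
      1 - (p : ℝ) ^ 2 * Real.exp (-(κ ^ 2 / 16 * c₀ * n * lam ^ 2)) ≤ μ.real E ∧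
      ∀ ω ∈ E, ∃ Θ : Matrix (Fin p) (Fin p) ℝ,
        RankGlasso.IsRankGlasso (fun k => X k ω) lam Θ ∧
        (∀ i j, S⁻¹ i j ≠ 0 → SignType.sign (Θ i j) = SignType.sign (S⁻¹ i j)) ∧
        (∀ i j, S⁻¹ i j = 0 → Θ i j = 0)) := by
  refine ⟨1 / 4096, by norm_num, ?_⟩
  intro n p hn S hS hdiag P hP Ω _ μ _ X hX hind κ hκ hκ1 hirr lam hlam hcond
  have hε : 0 < κ / 4 * lam := by positivity
  obtain ⟨E, hE, hEμ, hEω⟩ := RankGlasso.exists_event_rankCorr_close hn hS.posSemidef hdiag hP hX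
    hind hε
  have hexp : κ ^ 2 / 16 * (1 / 4096) * n * lam ^ 2 = 1 / 4096 * n * (κ / 4 * lam) ^ 2 := by ring
  rw [← hexp] at hEμ
  have hΘ : ∀ ω ∈ E, ∃ Θ, RankGlasso.IsRankGlasso (fun k => X k ω) lam Θ ∧
      (∀ i j, S⁻¹ i j = 0 → Θ i j = 0) ∧
      ∀ i j, |Θ i j - S⁻¹ i j| ≤ 2 * RankGlasso.KH S * (1 + κ / 4) * lam := fun ω hω =>
    RankGlasso.glasso_of_close hS hdiag hκ hκ1 hirr hlam hcond
      (RankGlasso.rankCorr_transpose _) (hEω ω hω).1 (hEω ω hω).2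
  refine ⟨⟨E, hE, hEμ, fun ω hω => ?_⟩, fun hψ => ⟨E, hE, hEμ, fun ω hω => ?_⟩⟩
  · obtain ⟨Θ, h1, h2, h3⟩ := hΘ ω hω
    refine ⟨Θ, h1, h2, Real.iSup_le (fun e => h3 e.1 e.2) ?_⟩
    have := RankGlasso.KH_nonneg S
    positivity
  · obtain ⟨Θ, h1, h2, h3⟩ := hΘ ω hω
    refine ⟨Θ, h1, fun i j hij => ?_, h2⟩
    rcases eq_or_ne i j with rfl | hne
    · rw [sign_pos h1.1.1.diag_pos, sign_pos hS.inv.diag_pos]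
    · refine RankGlasso.sign_eq_of_abs_sub_lt ((h3 i j).trans_lt ?_)
      have h4 : RankGlasso.psiMin S⁻¹ ≤ ((|S⁻¹ i j| : ℝ) : EReal) :=
        iInf_le_of_le i (iInf_le_of_le j (iInf_le _ ⟨hne, hij⟩))
      have h5 := EReal.coe_lt_coe_iff.1 (hψ.trans_le h4)
      linarith
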